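/- **Setting.** Let $(S,A,P,\rho,\gamma,R,(C_i)_{i=1}^N)$ be a constrained MDP with finite $S$ and $A$, discount $\gamma\in(0,1)$, reward $|R|\le R_{\max}$ and costs $0\le C_i\le C_{\max}$. The augmented state at time $t$ is $\bar s_t=(s_t,(e_{i,t})_i,b_t)$ with $e_{i,0}=0$, $e_{i,t+1}=(C_i(s_t,a_t,s_{t+1})+e_{i,t})/\gamma$, $b_t=\gamma^t$. Policies $\pi(\cdot\mid\bar s)$ are tabular: a finite set $H$ of augmented states and a policy $\pi_0$ are fixed, and $\Pi$ is the set of all policies that agree with $\pi_0$ outside $H$ (no restriction if the augmented states outside $H$ are unreachable or have no influence on rewards and costs). Let $G_R^\pi=\sum_t\gamma^tR(s_t,a_t,s_{t+1})$ and $G_{C_i}^\pi=\sum_t\gamma^tC_i(s_t,a_t,s_{t+1})$ be the returns under $\pi$, $J_R(\pi)=\mathbb E[G_R^\pi]$, and let $d_i\in\mathbb R$ be thresholds. For each $i$ let $\sigma_i(u)=\eta_{i,1}+\sum_{j=1}^{M-1}(\eta_{i,j+1}-\eta_{i,j})\mathbf 1_{u\ge\kappa_{i,j}}$ be a discretized spectrum,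 where $0\le\eta_{i,j}\le\eta_{i,j+1}$, $0\le\kappa_{i,j}\le\kappa_{i,j+1}\le1$ and $\int_0^1\sigma_i=1$. For $\beta=(\beta_1,\dots,\beta_N)$ with nondecreasing $\beta_i\in\mathbb R^{M-1}$ put $$g_{\beta_i}(x)=\eta_{i,1}x+\sum_{j=1}^{M-1}(\eta_{i,j+1}-\eta_{i,j})(x-\beta_i[j])_+,\qquad J_{C_i}(\pi;\beta)=\mathbb E[g_{\beta_i}(G_{C_i}^\pi)]+\int_0^1g_{\beta_i}^*(\sigma_i(u))\,du,$$ where $g^*(y)=\sup_x(xy-g(x))$, and $J(\pi;\beta)=J_R(\pi)-K\sum_i(J_{C_i}(\pi;\beta)-d_i)_+$. Let $\mathcal B$ be a finite nonempty set of such $\beta$. The inner problem at $\beta$ is to maximize $J_R(\pi)$ over $\pi\in\Pi$ subject to $J_{C_i}(\pi;\beta)\le d_i$ for all $i$; its value is $v(\beta)$, with $v(\beta)=-\infty$ if it is infeasible. A parameter $\beta\in\mathcal B$ is *optimal* if $v(\beta)=\max_{\beta'\in\mathcal B}v(\beta')$. Assume that for every $\beta\in\mathcal B$ the inner problem is either infeasible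 or strictly feasible, i.e. there are $\pi_f\in\Pi$ and $\epsilon>0$ with $J_{C_i}(\pi_f;\beta)\le d_i-\epsilon$ for all $i$. **Inner updates.** For each $\beta\in\mathcal B$ let $\pi_{\beta,t}=\pi_{\theta_t}$ (with $\theta_t=\theta_{\beta,t}$), where $\pi_\theta(a\mid\bar s)=e^{\theta(\bar s,a)}/\sum_{a'}e^{\theta(\bar s,a')}$ on $H$ and $\pi_\theta=\pi_0$ outside $H$, $\theta_0$ is arbitrary, and $$\theta_{t+1}=\theta_t+\alpha_tF^\dagger(\theta_t)\nabla_\theta\begin{cases}J_R(\pi_\theta)-\alpha_t\sum_i\lambda_{t,i}J_{C_i}(\pi_\theta;\beta)&\text{if }J_{C_i}(\pi_{\theta_t};\beta)\le d_i\ \forall i,\\ \alpha_t\nu_tJ_R(\pi_\theta)-\sum_i\lambda_{t,i}J_{C_i}(\pi_\theta;\beta)&\text{otherwise}\end{cases}\Bigg|_{\theta=\theta_t}.$$ Here $F(\theta)=\mathbb E_{\bar s\sim d_\rho^{\pi_\theta},\,a\sim\pi_\theta}[\nabla\log\pi_\theta(a|\bar s)\nabla\log\pi_\theta(a|\bar s)^{\mathsf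 T}]$ is the Fisher information matrix, $d_\rho^\pi(\bar s)=(1-\gamma)\sum_t\gamma^t\mathbb P(\bar s_t=\bar s)$, $\dagger$ is the Moore–Penrose inverse, $\alpha_t>0$ with $\sum_t\alpha_t=\infty$ and $\sum_t\alpha_t^2<\infty$, and the weights $\lambda_{t,i},\nu_t\in[0,\lambda_{\max}]$ are arbitrary except that, in the second case, $\lambda_{t,i}=0$ whenever $J_{C_i}(\pi_{\theta_t};\beta)\le d_i$ and $\sum_i\lambda_{t,i}=1$. **Sampler updates.** Let $\xi_\phi(\beta)=e^{\phi(\beta)}/\sum_{\beta'\in\mathcal B}e^{\phi(\beta')}$ for $\phi\in\mathbb R^{\mathcal B}$, let $\bar\xi_t(\beta)\propto\exp(J(\pi_{\beta,t};\beta))$ and $\mathcal L_t(\phi)=-\mathbb E_{\beta\sim\xi_\phi}[\log\bar\xi_t(\beta)]$. Let $\phi_0$ be arbitrary, $\alpha>0$, and $\phi_{t+1}=\phi_t-\alpha F^\dagger(\phi_t)\nabla_\phi\mathcal L_t(\phi)|_{\phi=\phi_t}$, where $F(\phi)$ is the Fisher information matrix of $\xi_\phi$. **Theorem.** Let $\Xi^*$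 be the set of optimal distributions, i.e. of probability distributions on $\mathcal B$ that vanish at every non-optimal $\beta$. For all sufficiently large $K>0$ (for every $K>0$ if all inner problems are strictly feasible) and all runs of the updates above, the sampler converges to the set of optimal distributions: $\Xi^*\neq\emptyset$ and $\operatorname{dist}(\xi_{\phi_t},\Xi^*)\to0$. Equivalently, $\xi_{\phi_t}(\beta)\to0$ for every non-optimal $\beta\in\mathcal B$. In particular, if the optimal parameter $\beta^*$ is unique, then $\xi_{\phi_t}(\beta^*)\to1$. -/

import Mathlib

open MeasureTheory ProbabilityTheory Filter Topology

noncomputable section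

/-! ### Linear algebra: the Moore–Penrose inverse of a real matrix -/

/-- `X` satisfies the four Penrose equations for the real square matrix `M`. -/
structure IsMoorePenrose {n : Type*} [Fintype n] (M X : Matrix n n ℝ) : Prop where
  mul_mul_self : M * X * M = M
  self_mul_mul : X * M * X = X
  left_symm : (M * X).transpose = M * X
  right_symm : (X * M).transpose = X * M

theorem IsMoorePenrose.unique {n : Type*} [Fintype n] {M X Y : Matrix n n ℝ}
    (hX : IsMoorePenrose M X) (hY : IsMoorePenrose M Y) : X = Y := by
  have h1 : M * X = M * Y := by
    calc M * X = (M * Y) * (M * X) := by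
          rw [← Matrix.mul_assoc, hY.mul_mul_self]
      _ = (M * Y).transpose * (M * X).transpose := by rw [hY.left_symm, hX.left_symm]
      _ = ((M * X) * (M * Y)).transpose := (Matrix.transpose_mul _ _).symm
      _ = (M * Y).transpose := by rw [← Matrix.mul_assoc, hX.mul_mul_self]
      _ = M * Y := hY.left_symm
  have h2 : X * M = Y * M := by
    calc X * M = (X * M) * (Y * M) := by
          rw [Matrix.mul_assoc, ← Matrix.mul_assoc M, hY.mul_mul_self]
      _ = (X * M).transpose * (Y * M).transpose := by rw [hY.right_symm, hX.right_symm]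
      _ = ((Y * M) * (X * M)).transpose := (Matrix.transpose_mul _ _).symm
      _ = (Y * M).transpose := by rw [Matrix.mul_assoc, ← Matrix.mul_assoc M, hX.mul_mul_self]
      _ = Y * M := hY.right_symm
  calc X = X * M * X := hX.self_mul_mul.symm
    _ = Y * (M * X) := by rw [h2, Matrix.mul_assoc]
    _ = Y * M * Y := by rw [h1, Matrix.mul_assoc]
    _ = Y := hY.self_mul_mul

/-- Every symmetric real matrix has a Moore–Penrose inverse. -/
theorem exists_isMoorePenrose {n : Type*} [Fintype n] {M : Matrix n n ℝ}
    (hM : M.transpose = M) : ∃ X, IsMoorePenrose M X := by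
  classical
  have hH : M.IsHermitian := by
    rw [Matrix.IsHermitian, Matrix.conjTranspose_eq_transpose_of_trivial, hM]
  set U : Matrix n n ℝ := (hH.eigenvectorUnitary : Matrix n n ℝ) with hU
  have hUU : star U * U = 1 := Unitary.coe_star_mul_self hH.eigenvectorUnitary
  let D : (n → ℝ) → Matrix n n ℝ := fun v => U * Matrix.diagonal v * star U
  have hmul : ∀ v w, D v * D w = D (fun i => v i * w i) := by
    intro v w
    calc D v * D w
        = U * Matrix.diagonal v * (star U * U) * Matrix.diagonal w * star U := by
          simp only [D, Matrix.mul_assoc]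
      _ = D (fun i => v i * w i) := by
          rw [hUU, Matrix.mul_one, Matrix.mul_assoc U, Matrix.diagonal_mul_diagonal]
  have hsymm : ∀ v, (D v).transpose = D v := by
    intro v
    simp only [D, Matrix.transpose_mul, Matrix.star_eq_conjTranspose,
      Matrix.conjTranspose_eq_transpose_of_trivial, Matrix.transpose_transpose,
      Matrix.diagonal_transpose, Matrix.mul_assoc]
  obtain ⟨v, hv⟩ : ∃ v, M = D v := by
    refine ⟨hH.eigenvalues, ?_⟩
    have := hH.spectral_theorem
    rw [Unitary.conjStarAlgAut_apply] at this
    simpa [D, hU] using this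
  refine ⟨D (fun i => (v i)⁻¹), ?_, ?_, ?_, ?_⟩
  · rw [hv, hmul, hmul]; congr 1; funext i
    exact mul_inv_mul_cancel _
  · rw [hv, hmul, hmul]; congr 1; funext i
    simpa using mul_inv_mul_cancel (v i)⁻¹
  · rw [hv, hmul, hsymm]
  · rw [hv, hmul, hsymm]

open Classical in
/-- The Moore–Penrose inverse `M†` (of a symmetric matrix `M`). -/
def pinv {n : Type*} [Fintype n] (M : Matrix n n ℝ) : Matrix n n ℝ :=
  if h : ∃ X, IsMoorePenrose M X then h.choose else 0

theorem isMoorePenrose_pinv {n : Type*} [Fintype n] {M : Matrix n n ℝ}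
    (hM : M.transpose = M) : IsMoorePenrose M (pinv M) := by
  have h := exists_isMoorePenrose hM
  rw [pinv, dif_pos h]
  exact h.choose_spec

/-! ### Distributions on finite types -/

/-- The softmax distribution `i ↦ exp (v i) / ∑ j, exp (v j)`. -/
def softmax {ι : Type*} [Fintype ι] [Nonempty ι] (v : ι → ℝ) : stdSimplex ℝ ι :=
  ⟨fun i => Real.exp (v i) / ∑ j, Real.exp (v j),
    fun i => by positivity,
    by
      rw [← Finset.sum_div]
      exact div_self (Finset.sum_pos (fun j _ => Real.exp_pos _) Finset.univ_nonempty).ne'⟩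

/-- Cross-entropy `H(p, q) = - E_{i ∼ p} [log q i]`. -/
def crossEntropy {ι : Type*} [Fintype ι] (p q : stdSimplex ℝ ι) : ℝ :=
  - ∑ i, p i * Real.log (q i)

/-- The measure with point weights `w`. -/
def weightMeasure {X : Type*} [Fintype X] [MeasurableSpace X] (w : X → ℝ) : Measure X :=
  ∑ x, ENNReal.ofReal (w x) • Measure.dirac x

theorem isProbabilityMeasure_weightMeasure {X : Type*} [Fintype X] [MeasurableSpace X]
    {w : X → ℝ} (h0 : ∀ x, 0 ≤ w x) (h1 : ∑ x, w x = 1) :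
    IsProbabilityMeasure (weightMeasure w) := by
  refine ⟨?_⟩
  simp only [weightMeasure, Measure.coe_finsetSum, Finset.sum_apply, Measure.smul_apply,
    measure_univ, smul_eq_mul, mul_one]
  rw [← ENNReal.ofReal_sum_of_nonneg (fun x _ => h0 x), h1, ENNReal.ofReal_one]

/-! ### Constrained Markov decision processes -/

/-- A finite constrained Markov decision process with `N` costs. -/
structure CMDP (S A : Type*) [Fintype S] [Fintype A] (N : ℕ) where
  /-- transition model -/
  P : S → A → stdSimplex ℝ S
  /-- initial state distribution -/
  ρ : stdSimplex ℝ S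
  /-- discount factor -/
  γ : ℝ
  γ_pos : 0 < γ
  γ_lt_one : γ < 1
  /-- reward function -/
  R : S → A → S → ℝ
  /-- cost functions -/
  C : Fin N → S → A → S → ℝ
  Rmax : ℝ
  Cmax : ℝ
  abs_R_le : ∀ s a s', |R s a s'| ≤ Rmax
  C_nonneg : ∀ i s a s', 0 ≤ C i s a s'
  C_le : ∀ i s a s', C i s a s' ≤ Cmax

/-- Augmented states `(s, (e_i)_i, b)`. -/
abbrev AugState (S : Type*) (N : ℕ) : Type _ := S × (Fin N → ℝ) × ℝ

/-- Policies on the augmented state space. -/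
abbrev Policy (S A : Type*) [Fintype A] (N : ℕ) : Type _ := AugState S N → stdSimplex ℝ A

/-- State-action pairs, a finite discrete space; a trajectory is a map `ℕ → Step S A`. -/
@[ext] structure Step (S A : Type*) where
  s : S
  a : A

def Step.equivProd (S A : Type*) : Step S A ≃ S × A where
  toFun x := (x.s, x.a)
  invFun x := ⟨x.1, x.2⟩
  left_inv _ := rfl
  right_inv _ := rfl

instance Step.instFintype {S A : Type*} [Fintype S] [Fintype A] : Fintype (Step S A) :=
  Fintype.ofEquiv (S × A) (Step.equivProd S A).symm

instance Step.instMeasurableSpace {S A : Type*} : MeasurableSpace (Step S A) := ⊤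

namespace CMDP

variable {S A : Type*} [Fintype S] [Fintype A] {N : ℕ} (M : CMDP S A N)

/-- `e_{i,0} = 0`, `e_{i,t+1} = (C_i(s_t, a_t, s_{t+1}) + e_{i,t}) / γ`. -/
def accCost (ω : ℕ → Step S A) (i : Fin N) : ℕ → ℝ
  | 0 => 0
  | t + 1 => (M.C i (ω t).s (ω t).a (ω (t + 1)).s + accCost ω i t) / M.γ

/-- The augmented state at time `t` along a trajectory, with `b_t = γ ^ t`. -/
def aug (ω : ℕ → Step S A) (t : ℕ) : AugState S N :=
  ((ω t).s, fun i => M.accCost ω i t, M.γ ^ t)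

/-- The trajectory that follows the history `h` up to time `n` and equals `x` afterwards. -/
def extend {n : ℕ} (h : (_ : Finset.Iic n) → Step S A) (x : Step S A) : ℕ → Step S A :=
  fun k => if hk : k ≤ n then h ⟨k, Finset.mem_Iic.2 hk⟩ else x

/-- Weights of the initial step: `s₀ ∼ ρ`, `a₀ ∼ π(· | s̄₀)`. -/
def initWeight (π : Policy S A N) (x : Step S A) : ℝ :=
  M.ρ x.s * π (M.aug (fun _ => x) 0) x.a

/-- Weights of the next step given the history `h` up to time `n`:
`s_{n+1} ∼ P(· | s_n, a_n)`, `a_{n+1} ∼ π(· | s̄_{n+1})`. -/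
def stepWeight (π : Policy S A N) {n : ℕ} (h : (_ : Finset.Iic n) → Step S A)
    (x : Step S A) : ℝ :=
  M.P (h ⟨n, Finset.mem_Iic.2 le_rfl⟩).s (h ⟨n, Finset.mem_Iic.2 le_rfl⟩).a x.s *
    π (M.aug (extend h x) (n + 1)) x.a

theorem accCost_congr {ω ω' : ℕ → Step S A} {i : Fin N} {t : ℕ}
    (h : ∀ k < t, ω k = ω' k) (hs : (ω t).s = (ω' t).s) :
    M.accCost ω i t = M.accCost ω' i t := by
  induction t with
  | zero => rfl
  | succ t ih =>
    have ht := h t (Nat.lt_succ_self t)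
    simp only [accCost, ht, hs]
    rw [ih (fun k hk => h k (hk.trans (Nat.lt_succ_self t))) (by rw [ht])]

theorem aug_congr {ω ω' : ℕ → Step S A} {t : ℕ}
    (h : ∀ k < t, ω k = ω' k) (hs : (ω t).s = (ω' t).s) : M.aug ω t = M.aug ω' t := by
  simp only [aug, hs]
  congr 2
  funext i
  exact M.accCost_congr h hs

theorem sum_step_eq (f : S → ℝ) (g : S → A → ℝ) (hf : ∑ s, f s = 1)
    (hg : ∀ s, ∑ a, g s a = 1) : ∑ x : Step S A, f x.s * g x.s x.a = 1 := by
  rw [Fintype.sum_equiv (Step.equivProd S A) (fun x => f x.s * g x.s x.a)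
    (fun y => f y.1 * g y.1 y.2) (fun _ => rfl), Fintype.sum_prod_type]
  simp only [← Finset.mul_sum, hg, mul_one, hf]

instance isProbabilityMeasure_init (π : Policy S A N) :
    IsProbabilityMeasure (weightMeasure (M.initWeight π)) :=
  isProbabilityMeasure_weightMeasure
    (fun x => mul_nonneg (stdSimplex.zero_le _ _) (stdSimplex.zero_le _ _))
    (sum_step_eq (fun s => M.ρ s) (fun s a => π (s, fun _ => 0, M.γ ^ 0) a)
      (stdSimplex.sum_eq_one _) (fun _ => stdSimplex.sum_eq_one _))

theorem sum_stepWeight (π : Policy S A N) {n : ℕ} (h : (_ : Finset.Iic n) → Step S A) :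
    ∑ x, M.stepWeight π h x = 1 := by
  by_cases hA : Nonempty A
  · obtain ⟨a₀⟩ := hA
    have key : ∀ x : Step S A,
        M.aug (extend h x) (n + 1) = M.aug (extend h ⟨x.s, a₀⟩) (n + 1) := by
      intro x
      refine M.aug_congr (fun k hk => ?_) ?_
      · simp [extend, Nat.lt_succ_iff.1 hk]
      · simp [extend]
    simp only [stepWeight, key]
    exact sum_step_eq
      (fun s => M.P (h ⟨n, Finset.mem_Iic.2 le_rfl⟩).s (h ⟨n, Finset.mem_Iic.2 le_rfl⟩).a s)
      (fun s a => π (M.aug (extend h ⟨s, a₀⟩) (n + 1)) a)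
      (stdSimplex.sum_eq_one _) (fun _ => stdSimplex.sum_eq_one _)
  · exact absurd ⟨(h ⟨n, Finset.mem_Iic.2 le_rfl⟩).a⟩ hA

/-- The transition kernel of the state-action process under `π`. -/
def stepKernel (π : Policy S A N) (n : ℕ) :
    Kernel ((_ : Finset.Iic n) → Step S A) (Step S A) where
  toFun h := weightMeasure (M.stepWeight π h)
  measurable' := .of_discrete

instance isMarkovKernel_stepKernel (π : Policy S A N) (n : ℕ) :
    IsMarkovKernel (M.stepKernel π n) :=
  ⟨fun h => isProbabilityMeasure_weightMeasure
    (fun _ => mul_nonneg (stdSimplex.zero_le _ _) (stdSimplex.zero_le _ _))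
    (M.sum_stepWeight π h)⟩

/-- The law of the trajectory under `π`. -/
def law (π : Policy S A N) : Measure (ℕ → Step S A) :=
  Kernel.trajMeasure (X := fun _ => Step S A) (weightMeasure (M.initWeight π)) (M.stepKernel π)

/-- The discounted reward return of a trajectory. -/
def returnR (ω : ℕ → Step S A) : ℝ :=
  ∑' t, M.γ ^ t * M.R (ω t).s (ω t).a (ω (t + 1)).s

/-- The discounted return of the `i`-th cost of a trajectory. -/
def returnC (i : Fin N) (ω : ℕ → Step S A) : ℝ :=
  ∑' t, M.γ ^ t * M.C i (ω t).s (ω t).a (ω (t + 1)).s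

/-- `J_R(π) = E[G_R^π]`. -/
def JR (π : Policy S A N) : ℝ := ∫ ω, M.returnR ω ∂(M.law π)

/-- The discounted distribution `d_ρ^π(s̄) = (1 - γ) ∑_t γ^t P(s̄_t = s̄)` of augmented states. -/
def occupancy (π : Policy S A N) (x : AugState S N) : ℝ :=
  (1 - M.γ) * ∑' t, M.γ ^ t * (M.law π).real {ω | M.aug ω t = x}

end CMDP

/-! ### Discretized spectra, dual parameters, sub-risk measures -/

/-- The step function `u ↦ η_1 + ∑_j (η_{j+1} - η_j) 1_{u ≥ κ_j}` with `m` jumps. -/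
def stepSpectrum {m : ℕ} (η : Fin (m + 1) → ℝ) (κ : Fin m → ℝ) (u : ℝ) : ℝ :=
  η 0 + ∑ j : Fin m, (η j.succ - η j.castSucc) * if κ j ≤ u then 1 else 0

/-- A discretized spectrum with `m` jumps, that is, with `m + 1` discretization levels. -/
structure DiscreteSpectrum (m : ℕ) where
  η : Fin (m + 1) → ℝ
  κ : Fin m → ℝ
  η_nonneg : ∀ j, 0 ≤ η j
  η_mono : Monotone η
  κ_mono : Monotone κ
  κ_mem : ∀ j, κ j ∈ Set.Icc (0 : ℝ) 1
  integral_eq_one : ∫ u in (0 : ℝ)..1, stepSpectrum η κ u = 1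

namespace DiscreteSpectrum

variable {m : ℕ} (σ : DiscreteSpectrum m)

/-- The spectrum as a function on `[0, 1]`. -/
def fn (u : ℝ) : ℝ := stepSpectrum σ.η σ.κ u

/-- `g_β(x) = η_1 x + ∑_j (η_{j+1} - η_j) (x - β[j])_+`. -/
def g (β : Fin m → ℝ) (x : ℝ) : ℝ :=
  σ.η 0 * x + ∑ j : Fin m, (σ.η j.succ - σ.η j.castSucc) * max (x - β j) 0

/-- The convex conjugate `g_β^*(y) = sup_x (x y - g_β(x))`; the supremum is finite for
`y` in `[η_1, η_M]`, hence at all values of the spectrum. -/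
def conj (β : Fin m → ℝ) (y : ℝ) : ℝ := ⨆ x : ℝ, (x * y - σ.g β x)

end DiscreteSpectrum

/-- Families `β = (β_1, …, β_N)` of dual parameters `β_i ∈ ℝ^m`. -/
abbrev DualParam (N m : ℕ) : Type := Fin N → Fin m → ℝ

/-- The penalty `0` if `x ≤ 0` and `∞` otherwise. -/
def feasPenalty (x : ℝ) : EReal := if x ≤ 0 then 0 else ⊤

/-- A risk-constrained problem over a finite CMDP. Policies are tabular: `table` is the finite set
of augmented states at which a policy is free, and at all other augmented states every policy
equals the fixed policy `default`. (Where all augmented states outside `table` are either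
unreachable or without influence on rewards and costs, this restricts nothing.) -/
structure RCProblem (S A : Type*) [Fintype S] [Fintype A] (N m : ℕ) extends CMDP S A N where
  /-- spectra of the constraints -/
  σ : Fin N → DiscreteSpectrum m
  /-- thresholds of the constraints -/
  d : Fin N → ℝ
  table : Finset (AugState S N)
  default : Policy S A N

namespace RCProblem

variable {S A : Type*} [Fintype S] [Fintype A] {N m : ℕ} (M : RCProblem S A N m)

/-- The admissible (tabular) policies. -/
def policies : Set (Policy S A N) := {π | ∀ x, x ∉ M.table → π x = M.default x}

/-- `J_{C_i}(π; β) = E[g_{β_i}(G_{C_i}^π)] + ∫_0^1 g_{β_i}^*(σ_i(u)) du`, the sub-risk measure. -/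
def JC (β : DualParam N m) (i : Fin N) (π : Policy S A N) : ℝ :=
  (∫ ω, (M.σ i).g (β i) (M.returnC i ω) ∂(M.law π)) +
    ∫ u in (0 : ℝ)..1, (M.σ i).conj (β i) ((M.σ i).fn u)

/-- The policy `π` satisfies the constraints of the inner problem at `β`. -/
def Satisfies (β : DualParam N m) (π : Policy S A N) : Prop := ∀ i, M.JC β i π ≤ M.d i

/-- The inner problem at `β` has a feasible policy. -/
def Feasible (β : DualParam N m) : Prop := ∃ π ∈ M.policies, M.Satisfies β π

/-- Some policy satisfies all constraints of the inner problem at `β` with a margin. -/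
def StrictlyFeasible (β : DualParam N m) : Prop :=
  ∃ π ∈ M.policies, ∃ ε > 0, ∀ i, M.JC β i π ≤ M.d i - ε

/-- The value `max_π J_R(π) - ∑_i F(J_{C_i}(π; β) - d_i)` of the inner problem at `β`;
it is `J_R(π_β^*)` when the inner problem is feasible and `-∞` otherwise. -/
def innerValue (β : DualParam N m) : EReal :=
  ⨆ π ∈ M.policies, ((M.JR π : EReal) - ∑ i, feasPenalty (M.JC β i π - M.d i))

/-- `β` is an optimal solution of the outer problem over the finite parameter space `B`. -/
def IsOptimal (B : Finset (DualParam N m)) (β : DualParam N m) : Prop :=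
  β ∈ B ∧ ∀ β' ∈ B, M.innerValue β' ≤ M.innerValue β

/-- The penalized objective `J(π; β) = J_R(π) - K ∑_i (J_{C_i}(π; β) - d_i)_+`. -/
def J (K : ℝ) (β : DualParam N m) (π : Policy S A N) : ℝ :=
  M.JR π - K * ∑ i, max (M.JC β i π - M.d i) 0

/-! #### The inner policy updates -/

/-- Policy parameters `θ(s̄, a)`. -/
abbrev Param : Type _ := EuclideanSpace ℝ (M.table × A)

variable [Nonempty A]

open Classical in
/-- The softmax policy `π_θ`. -/
def policy (θ : M.Param) : Policy S A N :=
  fun x => if hx : x ∈ M.table then softmax (fun a => θ (⟨x, hx⟩, a)) else M.default x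

/-- The score `∇_θ log π_θ(a | s̄)`. -/
def score (θ : M.Param) (x : AugState S N) (a : A) : M.Param :=
  gradient (fun θ' : M.Param => Real.log (M.policy θ' x a)) θ

/-- The Fisher information matrix
`F(θ) = E_{s̄ ∼ d_ρ^{π_θ}, a ∼ π_θ(· | s̄)} [∇ log π_θ(a | s̄) (∇ log π_θ(a | s̄))ᵀ]`.
Augmented states outside the table have zero score and are left out of the sum. -/
def fisher (θ : M.Param) : Matrix (M.table × A) (M.table × A) ℝ :=
  ∑ x : M.table, ∑ a : A, (M.occupancy (M.policy θ) x * M.policy θ x a) •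
    Matrix.vecMulVec (M.score θ x a) (M.score θ x a)

open Classical in
/-- The gradient in the policy update at step size `α` with weights `lam`, `ν`. -/
def updateGradient (β : DualParam N m) (α : ℝ) (lam : Fin N → ℝ) (ν : ℝ) (θ : M.Param) :
    M.Param :=
  if M.Satisfies β (M.policy θ) then
    gradient (fun θ' : M.Param =>
      M.JR (M.policy θ') - α * ∑ i, lam i * M.JC β i (M.policy θ')) θ
  else
    gradient (fun θ' : M.Param =>
      α * ν * M.JR (M.policy θ') - ∑ i, lam i * M.JC β i (M.policy θ')) θ

/-- `θ_0, θ_1, …` are generated by the policy update rule of the inner problem at `β`, with step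
sizes subject to the Robbins–Monro condition and any admissible choice of the weights. -/
def IsPolicyRun (β : DualParam N m) (θ : ℕ → M.Param) : Prop :=
  ∃ (α : ℕ → ℝ) (lam : ℕ → Fin N → ℝ) (ν : ℕ → ℝ) (lamMax : ℝ),
    (∀ t, 0 < α t) ∧ ¬ Summable α ∧ Summable (fun t => α t ^ 2) ∧
    (∀ t i, lam t i ∈ Set.Icc 0 lamMax) ∧ (∀ t, ν t ∈ Set.Icc 0 lamMax) ∧
    (∀ t, ¬ M.Satisfies β (M.policy (θ t)) →
      (∀ i, M.JC β i (M.policy (θ t)) ≤ M.d i → lam t i = 0) ∧ ∑ i, lam t i = 1) ∧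
    ∀ t, θ (t + 1) = θ t + α t • WithLp.toLp 2 ((pinv (M.fisher (θ t))).mulVec
      (M.updateGradient β (α t) (lam t) (ν t) (θ t)).ofLp)

end RCProblem

/-! ### The sampler -/

/-- The sampler `ξ_φ`, parameterized by softmax over the finite parameter space `B`. -/
def sampler {ι : Type*} [Fintype ι] [Nonempty ι] (φ : EuclideanSpace ℝ ι) : stdSimplex ℝ ι :=
  softmax (fun β => φ β)

/-- The score `∇_φ log ξ_φ(β)`. -/
def samplerScore {ι : Type*} [Fintype ι] [Nonempty ι] (φ : EuclideanSpace ℝ ι) (β : ι) :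
    EuclideanSpace ℝ ι :=
  gradient (fun φ' : EuclideanSpace ℝ ι => Real.log (sampler φ' β)) φ

/-- The Fisher information matrix of `ξ_φ`. -/
def samplerFisher {ι : Type*} [Fintype ι] [Nonempty ι] (φ : EuclideanSpace ℝ ι) :
    Matrix ι ι ℝ :=
  ∑ β, sampler φ β • Matrix.vecMulVec (samplerScore φ β) (samplerScore φ β)

namespace RCProblem

variable {S A : Type*} [Fintype S] [Fintype A] [Nonempty A] {N m : ℕ} (M : RCProblem S A N m)
  (B : Finset (DualParam N m)) [Nonempty B]

/-- The target `ξ̄(β) ∝ exp (J(π_β; β))` built from the policies `π_β` with parameters `θ β`. -/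
def target (K : ℝ) (θ : B → M.Param) : stdSimplex ℝ B :=
  softmax (fun β => M.J K β (M.policy (θ β)))

/-- The loss `L(φ) = H(ξ_φ, ξ̄)`. -/
def loss (K : ℝ) (θ : B → M.Param) (φ : EuclideanSpace ℝ B) : ℝ :=
  crossEntropy (sampler φ) (M.target B K θ)

/-- `φ_{t+1} = φ_t - α F†(φ_t) ∇_φ L_t(φ_t)`, where the loss `L_t` is built from the policies
`π_{β,t}` with parameters `θ β t`. -/
def IsSamplerRun (K α : ℝ) (θ : B → ℕ → M.Param) (φ : ℕ → EuclideanSpace ℝ B) : Prop :=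
  ∀ t, φ (t + 1) = φ t - α • WithLp.toLp 2 ((pinv (samplerFisher (φ t))).mulVec
    (gradient (M.loss B K (fun β => θ β t)) (φ t)).ofLp)

/-- The optimal distributions: those that vanish at every non-optimal parameter. -/
def optimalDistributions : Set (stdSimplex ℝ B) :=
  {ξ | ∀ β : B, ¬ M.IsOptimal B β → ξ β = 0}

end RCProblem

end

/-! For softmax parameters a natural gradient step is a mirror descent step: after applying the
inverse Fisher matrix, the logits move by the underlying values, up to additive constants that
softmax does not see (`naturalGradient_eq`). Both the policies and the sampler are analysed this
way.

Sampler. The logit difference of two parameters changes at each update by `α` times the difference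
of their current penalized objectives (`IsSamplerRun.sub_succ`). It therefore suffices that the
objective at an optimal parameter eventually exceeds the one at any non-optimal parameter by a fixed
margin (`exists_eventually_lt`): the non-optimal probability then decays exponentially. At an
infeasible parameter, compactness bounds the total violation away from zero, so a large `K` keeps
the objective low. At a strictly feasible one, the objective converges to the value of the inner
problem (`tendsto_J_of_strictlyFeasible`).

Inner problem. The components `e` and `b` turn the reward objective and every sub-risk measure into
a constant plus an expected total reward on augmented states (`isAdditive_JC`), so the performance
difference identity `IsAdditive.sub_eq` applies to them. With it, one update decreases the
cross-entropy of `π_θ` relative to any admissible policy `π`, weighted by the occupancy of `π`, by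
`α_t` times an advantage of `π`, up to `O(α_t²)` (`potential_step`, `IsPolicyRun.descent`). Mixing
the potentials of an optimal and a strictly feasible policy and using `∑ α_t = ∞` yields feasible,
nearly optimal iterates infinitely often (`IsPolicyRun.frequently`). A cluster point `π` of these is
an optimal policy. Its own potential is nonincreasing up to summable errors and approaches its
minimum along a subsequence, hence converges to it (`tendsto_of_quasiFejer`). The iterates then
converge to `π` at all table states that `π` visits, which is enough for the objectives to converge.
-/

noncomputable section

set_option linter.unusedSectionVars false

/-! ### The law of the trajectory: finite-dimensional recursion -/

theorem integral_weightMeasure {X : Type*} [Fintype X] [MeasurableSpace X]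
    [MeasurableSingletonClass X] {w : X → ℝ} (h0 : ∀ x, 0 ≤ w x) (f : X → ℝ) :
    ∫ x, f x ∂(weightMeasure w) = ∑ x, w x * f x := by
  rw [weightMeasure, integral_finsetSum_measure
    (fun x _ => (Integrable.of_finite).smul_measure ENNReal.ofReal_ne_top)]
  refine Finset.sum_congr rfl fun x _ => ?_
  rw [integral_smul_measure, integral_dirac, ENNReal.toReal_ofReal (h0 x), smul_eq_mul]

namespace CMDP

variable {S A : Type*} [Fintype S] [Fintype A] {N : ℕ} (M : CMDP S A N)

/-- The augmented state that follows `x` when `a` is taken and the state `s'` is reached. -/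
def next (x : AugState S N) (a : A) (s' : S) : AugState S N :=
  (s', fun i => (M.C i x.1 a s' + x.2.1 i) / M.γ, M.γ * x.2.2)

theorem aug_succ (ω : ℕ → Step S A) (t : ℕ) :
    M.aug ω (t + 1) = M.next (M.aug ω t) (ω t).a (ω (t + 1)).s := by
  simp only [aug, next, accCost, pow_succ']

/-- The augmented state at time `0`. -/
def start (s : S) : AugState S N := (s, fun _ => 0, 1)

theorem aug_zero (ω : ℕ → Step S A) : M.aug ω 0 = start (ω 0).s := by
  simp only [aug, start, accCost, pow_zero]

/-- Expectation of a state-action function at the next time. -/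
def trans (π : Policy S A N) (F : AugState S N → A → ℝ) (x : AugState S N) (a : A) : ℝ :=
  ∑ s', M.P x.1 a s' * ∑ a', π (M.next x a s') a' * F (M.next x a s') a'

/-- Expectation of a state-action function at time `n`. -/
def expect (π : Policy S A N) : ℕ → (AugState S N → A → ℝ) → ℝ
  | 0, F => ∑ s, M.ρ s * ∑ a, π (start s) a * F (start s) a
  | n + 1, F => expect π n (M.trans π F)

theorem sum_step (f : S → A → ℝ) : ∑ x : Step S A, f x.s x.a = ∑ s, ∑ a, f s a := by
  rw [Fintype.sum_equiv (Step.equivProd S A) (fun x => f x.s x.a)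
    (fun y => f y.1 y.2) (fun _ => rfl), Fintype.sum_prod_type]

instance isProbabilityMeasure_law (π : Policy S A N) : IsProbabilityMeasure (M.law π) := by
  unfold law; infer_instance

theorem map_zero_law (π : Policy S A N) :
    (M.law π).map (fun ω => ω 0) = weightMeasure (M.initWeight π) := by
  have h1 : (M.law π).map (Preorder.frestrictLe (π := fun _ => Step S A) 0) =
      (weightMeasure (M.initWeight π)).map
        (MeasurableEquiv.piUnique (fun _ : Finset.Iic 0 => Step S A)).symm := by
    rw [law, Kernel.trajMeasure, Measure.map_comp _ _ (by fun_prop), Kernel.traj_map_frestrictLe,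
      Kernel.partialTraj_self, Measure.id_comp]
  have h2 : (fun ω : ℕ → Step S A => ω 0) =
      (MeasurableEquiv.piUnique (fun _ : Finset.Iic 0 => Step S A)) ∘
        (Preorder.frestrictLe (π := fun _ => Step S A) 0) := by
    funext ω; rfl
  rw [h2, ← Measure.map_map (by fun_prop) (by fun_prop), h1,
    Measure.map_map (by fun_prop) (by fun_prop), MeasurableEquiv.self_comp_symm, Measure.map_id]

/-- Disintegration at time `n`: the joint law of the history and the next step is the
composition-product of the law of the history with `stepKernel`. -/
theorem integral_step (π : Policy S A N) (n : ℕ)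
    (G : ((_ : Finset.Iic n) → Step S A) → Step S A → ℝ) :
    ∫ ω, G (Preorder.frestrictLe (π := fun _ => Step S A) n ω) (ω (n + 1)) ∂(M.law π) =
      ∫ ω, ∑ x, M.stepWeight π (Preorder.frestrictLe (π := fun _ => Step S A) n ω) x *
        G (Preorder.frestrictLe (π := fun _ => Step S A) n ω) x ∂(M.law π) := by
  have hm : Measurable (fun ω : ℕ → Step S A =>
      (Preorder.frestrictLe (π := fun _ => Step S A) n ω, ω (n + 1))) := by fun_prop
  have h := Kernel.map_frestrictLe_trajMeasure_compProd_eq_map_trajMeasure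
    (X := fun _ => Step S A) (μ₀ := weightMeasure (M.initWeight π)) (κ := M.stepKernel π) (a := n)
  have hG : StronglyMeasurable (Function.uncurry G) := .of_discrete
  calc _ = ∫ z, Function.uncurry G z ∂((M.law π).map (fun ω : ℕ → Step S A =>
      (Preorder.frestrictLe (π := fun _ => Step S A) n ω, ω (n + 1)))) := by
        rw [integral_map hm.aemeasurable hG.aestronglyMeasurable]; rfl
    _ = _ := by
        rw [law, ← h, Measure.integral_compProd .of_finite, integral_map (by fun_prop)
          (StronglyMeasurable.of_discrete.aestronglyMeasurable)]
        refine integral_congr_ae (.of_forall fun ω => ?_)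
        exact integral_weightMeasure (fun _ => mul_nonneg (stdSimplex.zero_le _ _)
          (stdSimplex.zero_le _ _)) _

theorem extend_frestrictLe {n : ℕ} (ω : ℕ → Step S A) (x : Step S A) {k : ℕ} (hk : k ≤ n) :
    extend (Preorder.frestrictLe (π := fun _ => Step S A) n ω) x k = ω k := by
  simp [extend, hk]

theorem extend_succ {n : ℕ} (h : (_ : Finset.Iic n) → Step S A) (x : Step S A) :
    extend h x (n + 1) = x := by
  simp [extend]

theorem aug_extend_frestrictLe {n : ℕ} (ω : ℕ → Step S A) (x : Step S A) {k : ℕ} (hk : k ≤ n) :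
    M.aug (extend (Preorder.frestrictLe (π := fun _ => Step S A) n ω) x) k = M.aug ω k :=
  M.aug_congr (fun _ hj => extend_frestrictLe ω x (hj.le.trans hk))
    (by rw [extend_frestrictLe ω x hk])

theorem aug_extend_succ {n : ℕ} (ω : ℕ → Step S A) (x : Step S A) :
    M.aug (extend (Preorder.frestrictLe (π := fun _ => Step S A) n ω) x) (n + 1) =
      M.next (M.aug ω n) (ω n).a x.s := by
  rw [aug_succ, aug_extend_frestrictLe M ω x le_rfl, extend_frestrictLe ω x le_rfl, extend_succ]

/-- The step weight depends on the history only through the current augmented state and action, so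
the augmented process is Markov although the kernel is defined on histories. -/
theorem integral_next (π : Policy S A N) (n : ℕ) (G : AugState S N → A → S → A → ℝ) :
    ∫ ω, G (M.aug ω n) (ω n).a (ω (n + 1)).s (ω (n + 1)).a ∂(M.law π) =
      ∫ ω, ∑ s', M.P (M.aug ω n).1 (ω n).a s' *
        ∑ a', π (M.next (M.aug ω n) (ω n).a s') a' * G (M.aug ω n) (ω n).a s' a' ∂(M.law π) := by
  have h := M.integral_step π n (fun h x =>
    G (M.aug (extend h x) n) (h ⟨n, Finset.mem_Iic.2 le_rfl⟩).a x.s x.a)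
  simp only [aug_extend_frestrictLe M _ _ le_rfl] at h
  refine h.trans (integral_congr_ae (.of_forall fun ω => ?_))
  simp only [stepWeight, aug_extend_succ, Finset.mul_sum, ← mul_assoc]
  exact sum_step (fun s a => M.P (ω n).s (ω n).a s * π (M.next (M.aug ω n) (ω n).a s) a *
    G (M.aug ω n) (ω n).a s a)

/-- Expectations at time `n` under the law of the trajectory. -/
theorem integral_law (π : Policy S A N) (n : ℕ) (F : AugState S N → A → ℝ) :
    ∫ ω, F (M.aug ω n) (ω n).a ∂(M.law π) = M.expect π n F := by
  induction n generalizing F with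
  | zero =>
    have hm : Measurable (fun ω : ℕ → Step S A => ω 0) := by fun_prop
    calc _ = ∫ x, F (start x.s) x.a ∂((M.law π).map (fun ω => ω 0)) := by
          rw [integral_map hm.aemeasurable (StronglyMeasurable.of_discrete.aestronglyMeasurable)]
          simp only [aug_zero]
      _ = _ := by
          rw [map_zero_law, integral_weightMeasure (w := M.initWeight π)
            (fun _ => mul_nonneg (stdSimplex.zero_le _ _)
            (stdSimplex.zero_le _ _))]
          simp only [initWeight, aug_zero, expect, Finset.mul_sum, ← mul_assoc]
          exact sum_step (fun s a => M.ρ s * π (start s) a * F (start s) a)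
  | succ n ih =>
    rw [expect, ← ih]
    simp only [aug_succ]
    exact M.integral_next π n (fun x a s' a' => F (M.next x a s') a')

theorem integral_reward (π : Policy S A N) (n : ℕ) (r : AugState S N → A → S → ℝ) :
    ∫ ω, r (M.aug ω n) (ω n).a (ω (n + 1)).s ∂(M.law π) =
      M.expect π n (fun x a => ∑ s', M.P x.1 a s' * r x a s') := by
  rw [← integral_law]
  refine (M.integral_next π n (fun x a s' _ => r x a s')).trans
    (integral_congr_ae (.of_forall fun ω => ?_))
  simp only [← Finset.sum_mul, stdSimplex.sum_eq_one, one_mul]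

/-- Such a function factors through the finite discrete space of histories; padding with an
arbitrary step turns a history back into a trajectory. -/
theorem measurable_of_past {E : Type*} [MeasurableSpace E] {n : ℕ} {f : (ℕ → Step S A) → E}
    (hf : ∀ ω ω', (∀ k ≤ n, ω k = ω' k) → f ω = f ω') : Measurable f := by
  rcases isEmpty_or_nonempty (Step S A) with h | ⟨⟨x⟩⟩
  · exact measurable_of_empty f
  · have : f = (fun h => f (extend h x)) ∘ (Preorder.frestrictLe (π := fun _ => Step S A) n) := by
      funext ω
      exact hf _ _ fun k hk => (extend_frestrictLe ω x hk).symm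
    rw [this]
    exact Measurable.of_discrete.comp (by fun_prop)

theorem measurable_aug_comp {E : Type*} [MeasurableSpace E] (n : ℕ) (f : AugState S N → E) :
    Measurable (fun ω : ℕ → Step S A => f (M.aug ω n)) :=
  measurable_of_past (n := n) fun ω ω' h => by
    rw [M.aug_congr (fun k hk => h k hk.le) (by rw [h n le_rfl])]

open Classical in
/-- The probability of being in the augmented state `x` at time `n`. -/
def visit (π : Policy S A N) (x : AugState S N) (n : ℕ) : ℝ :=
  M.expect π n (fun y _ => if y = x then 1 else 0)

theorem law_real_aug (π : Policy S A N) (x : AugState S N) (n : ℕ) :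
    (M.law π).real {ω | M.aug ω n = x} = M.visit π x n := by
  classical
  have hm : MeasurableSet {ω : ℕ → Step S A | M.aug ω n = x} :=
    measurableSet_setOfPred.2 (M.measurable_aug_comp n (fun y => y = x))
  rw [visit, ← integral_law, ← integral_indicator_one hm]
  refine integral_congr_ae (.of_forall fun ω => ?_)
  simp [Set.indicator_apply]

end CMDP

/-! ### Additive objectives and the performance difference identity -/

namespace CMDP

variable {S A : Type*} [Fintype S] [Fintype A] {N : ℕ} (M : CMDP S A N)

theorem trans_add (π : Policy S A N) (F G : AugState S N → A → ℝ) :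
    M.trans π (fun x a => F x a + G x a) = fun x a => M.trans π F x a + M.trans π G x a := by
  funext x a
  simp only [trans, mul_add, Finset.sum_add_distrib]

theorem trans_mul_left (π : Policy S A N) (c : ℝ) (F : AugState S N → A → ℝ) :
    M.trans π (fun x a => c * F x a) = fun x a => c * M.trans π F x a := by
  funext x a
  simp only [trans, Finset.mul_sum]
  exact Finset.sum_congr rfl fun _ _ => Finset.sum_congr rfl fun _ _ => by ring

theorem expect_add (π : Policy S A N) (n : ℕ) (F G : AugState S N → A → ℝ) :
    M.expect π n (fun x a => F x a + G x a) = M.expect π n F + M.expect π n G := by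
  induction n generalizing F G with
  | zero => simp only [expect, mul_add, Finset.sum_add_distrib]
  | succ n ih => simp only [expect, trans_add, ih]

theorem expect_mul_left (π : Policy S A N) (n : ℕ) (c : ℝ) (F : AugState S N → A → ℝ) :
    M.expect π n (fun x a => c * F x a) = c * M.expect π n F := by
  induction n generalizing F with
  | zero =>
    simp only [expect, Finset.mul_sum]
    exact Finset.sum_congr rfl fun _ _ => Finset.sum_congr rfl fun _ _ => by ring
  | succ n ih => simp only [expect, trans_mul_left, ih]

theorem expect_sub (π : Policy S A N) (n : ℕ) (F G : AugState S N → A → ℝ) :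
    M.expect π n (fun x a => F x a - G x a) = M.expect π n F - M.expect π n G := by
  have h := M.expect_add π n F (fun x a => (-1) * G x a)
  rw [expect_mul_left] at h
  calc _ = M.expect π n (fun x a => F x a + (-1) * G x a) := by
        congr 1; funext x a; ring
    _ = _ := by rw [h]; ring

theorem expect_sum (π : Policy S A N) (n : ℕ) {ι : Type*} (T : Finset ι)
    (F : ι → AugState S N → A → ℝ) :
    M.expect π n (fun x a => ∑ i ∈ T, F i x a) = ∑ i ∈ T, M.expect π n (F i) := by
  classical
  induction T using Finset.induction_on with
  | empty =>
    simpa using M.expect_mul_left π n 0 (fun _ _ => 0)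
  | insert i T hi ih =>
    simp only [Finset.sum_insert hi, expect_add, ih]

theorem trans_mono (π : Policy S A N) {F G : AugState S N → A → ℝ} (h : ∀ x a, F x a ≤ G x a)
    (x : AugState S N) (a : A) : M.trans π F x a ≤ M.trans π G x a :=
  Finset.sum_le_sum fun _ _ => mul_le_mul_of_nonneg_left (Finset.sum_le_sum fun _ _ =>
    mul_le_mul_of_nonneg_left (h _ _) (stdSimplex.zero_le _ _)) (stdSimplex.zero_le _ _)

theorem expect_mono (π : Policy S A N) (n : ℕ) {F G : AugState S N → A → ℝ}
    (h : ∀ x a, F x a ≤ G x a) : M.expect π n F ≤ M.expect π n G := by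
  induction n generalizing F G with
  | zero =>
    exact Finset.sum_le_sum fun _ _ => mul_le_mul_of_nonneg_left (Finset.sum_le_sum fun _ _ =>
      mul_le_mul_of_nonneg_left (h _ _) (stdSimplex.zero_le _ _)) (stdSimplex.zero_le _ _)
  | succ n ih => exact ih (M.trans_mono π h)

theorem expect_nonneg (π : Policy S A N) (n : ℕ) {F : AugState S N → A → ℝ}
    (h : ∀ x a, 0 ≤ F x a) : 0 ≤ M.expect π n F := by
  have := M.expect_mono π n (F := fun x a => 0 * F x a) (G := F) (by simpa using h)
  rwa [expect_mul_left, zero_mul] at this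

/-- An average of averages is bounded by any bound on the averaged values. -/
theorem abs_average_le {f : S → ℝ} (hf : f ∈ stdSimplex ℝ S) (p : S → stdSimplex ℝ A)
    (G : S → A → ℝ) {c : ℝ} (hG : ∀ s a, |G s a| ≤ c) :
    |∑ s, f s * ∑ a, p s a * G s a| ≤ c := by
  have inner : ∀ s, |∑ a, p s a * G s a| ≤ c := fun s => by
    calc |∑ a, p s a * G s a| ≤ ∑ a, p s a * c :=
          (Finset.abs_sum_le_sum_abs _ _).trans (Finset.sum_le_sum fun a _ => by
            rw [abs_mul, abs_of_nonneg (stdSimplex.zero_le _ _)]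
            exact mul_le_mul_of_nonneg_left (hG s a) (stdSimplex.zero_le _ _))
      _ = c := by rw [← Finset.sum_mul, stdSimplex.sum_eq_one, one_mul]
  calc _ ≤ ∑ s, f s * c := (Finset.abs_sum_le_sum_abs _ _).trans (Finset.sum_le_sum fun s _ => by
            rw [abs_mul, abs_of_nonneg (hf.1 s)]
            exact mul_le_mul_of_nonneg_left (inner s) (hf.1 s))
    _ = c := by rw [← Finset.sum_mul, hf.2, one_mul]

/-- Each transition multiplies the component `b` by `γ`. Bounds proportional to `|b|` thus play the
role of discounting, and total rewards can be treated without an explicit discount factor. -/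
theorem abs_trans_le (π : Policy S A N) {F : AugState S N → A → ℝ} {c : ℝ}
    (h : ∀ x a, |F x a| ≤ c * |x.2.2|) (x : AugState S N) (a : A) :
    |M.trans π F x a| ≤ c * M.γ * |x.2.2| := by
  refine abs_average_le (M.P x.1 a).2 (fun s' => π (M.next x a s'))
    (fun s' a' => F (M.next x a s') a') fun s' a' => (h _ _).trans_eq ?_
  simp only [next, abs_mul, abs_of_pos M.γ_pos]
  ring

theorem abs_expect_le (π : Policy S A N) (n : ℕ) {F : AugState S N → A → ℝ} {c : ℝ}
    (h : ∀ x a, |F x a| ≤ c * |x.2.2|) : |M.expect π n F| ≤ c * M.γ ^ n := by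
  induction n generalizing F c with
  | zero =>
    refine abs_average_le M.ρ.2 (fun s => π (start s)) (fun s a => F (start s) a) fun s a =>
      (h _ _).trans_eq ?_
    simp [start]
  | succ n ih =>
    refine (ih (M.abs_trans_le π h)).trans_eq ?_
    ring

theorem expect_eq_zero (π : Policy S A N) (n : ℕ) {F : AugState S N → A → ℝ}
    (h : ∀ x a, x.2.2 = M.γ ^ n → F x a = 0) : M.expect π n F = 0 := by
  induction n generalizing F with
  | zero =>
    simp only [expect]
    refine Finset.sum_eq_zero fun s _ => ?_
    rw [Finset.sum_eq_zero, mul_zero]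
    intro a _
    rw [h _ _ (by simp [start]), mul_zero]
  | succ n ih =>
    refine ih fun x a hx => Finset.sum_eq_zero fun s _ => ?_
    rw [Finset.sum_eq_zero, mul_zero]
    intro a _
    rw [h _ _ (by simp only [next, hx, pow_succ']), mul_zero]

theorem trans_state (π π' : Policy S A N) (F : AugState S N → A → ℝ) :
    M.trans π' (fun x _ => ∑ a, π x a * F x a) = M.trans π F := by
  funext x a
  simp only [trans, ← Finset.sum_mul, stdSimplex.sum_eq_one, one_mul]

theorem expect_average (π : Policy S A N) (n : ℕ) (F : AugState S N → A → ℝ) :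
    M.expect π n (fun x _ => ∑ a, π x a * F x a) = M.expect π n F := by
  cases n with
  | zero => simp only [expect, ← Finset.sum_mul, stdSimplex.sum_eq_one, one_mul]
  | succ n => simp only [expect, trans_state]

/-! #### Visits of augmented states -/

theorem visit_nonneg (π : Policy S A N) (x : AugState S N) (n : ℕ) : 0 ≤ M.visit π x n :=
  M.expect_nonneg π n fun _ _ => by split_ifs <;> norm_num

theorem visit_eq_zero (π : Policy S A N) {x : AugState S N} {n : ℕ} (h : x.2.2 ≠ M.γ ^ n) :
    M.visit π x n = 0 :=
  M.expect_eq_zero π n fun y _ hy => if_neg fun hyx : y = x => h (hyx ▸ hy)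

/-- The expected number of visits of the augmented state `x`. -/
def visits (π : Policy S A N) (x : AugState S N) : ℝ := ∑' n, M.visit π x n

/-- The powers of `γ` are distinct and `b` equals `γ ^ n` at time `n`, so an augmented state can be
visited at one time only, and this time is the same for all policies. Series of visits thereby
reduce to finite-horizon quantities. -/
theorem visits_eq (x : AugState S N) :
    (∃ n, ∀ π : Policy S A N, HasSum (M.visit π x) (M.visit π x n)) ∨
      ∀ π : Policy S A N, HasSum (M.visit π x) 0 := by
  by_cases h : ∃ n, x.2.2 = M.γ ^ n
  · obtain ⟨n, hn⟩ := h
    refine .inl ⟨n, fun π => hasSum_single n fun k hk => M.visit_eq_zero π fun hx => hk ?_⟩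
    exact (pow_right_injective₀ M.γ_pos M.γ_lt_one.ne) (hx.symm.trans hn)
  · push Not at h
    refine .inr fun π => ?_
    have : M.visit π x = fun _ => 0 := funext fun n => M.visit_eq_zero π (h n)
    rw [this]
    exact hasSum_zero

theorem hasSum_visits (π : Policy S A N) (x : AugState S N) :
    HasSum (M.visit π x) (M.visits π x) := by
  rcases M.visits_eq x with ⟨n, h⟩ | h
  · exact (h π).summable.hasSum
  · exact (h π).summable.hasSum

theorem visits_nonneg (π : Policy S A N) (x : AugState S N) : 0 ≤ M.visits π x :=
  tsum_nonneg (M.visit_nonneg π x)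

/-- At the only time at which `x` can be visited, the discount factor is the component `b` of `x`
itself. -/
theorem occupancy_eq (π : Policy S A N) (x : AugState S N) :
    M.occupancy π x = (1 - M.γ) * x.2.2 * M.visits π x := by
  rw [occupancy, visits, mul_assoc, ← tsum_mul_left (a := x.2.2)]
  congr 2
  funext n
  rw [law_real_aug]
  by_cases h : x.2.2 = M.γ ^ n
  · rw [h]
  · rw [M.visit_eq_zero π h, mul_zero, mul_zero]

theorem pos_of_visits_ne_zero {π : Policy S A N} {x : AugState S N} (h : M.visits π x ≠ 0) :
    0 < x.2.2 := by
  by_contra hx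
  refine h ?_
  rw [visits]
  refine (tsum_congr fun n => M.visit_eq_zero π fun hn => hx ?_).trans tsum_zero
  rw [hn]
  exact pow_pos M.γ_pos n

theorem occupancy_nonneg (π : Policy S A N) (x : AugState S N) : 0 ≤ M.occupancy π x :=
  mul_nonneg (sub_pos.2 M.γ_lt_one).le (tsum_nonneg fun _ =>
    mul_nonneg (pow_pos M.γ_pos _).le measureReal_nonneg)

theorem occupancy_ne_zero {π : Policy S A N} {x : AugState S N} (h : M.visits π x ≠ 0) :
    M.occupancy π x ≠ 0 := by
  rw [occupancy_eq]
  exact mul_ne_zero (mul_ne_zero (sub_pos.2 M.γ_lt_one).ne' (M.pos_of_visits_ne_zero h).ne') h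

theorem visits_ne_zero_of_occupancy {π : Policy S A N} {x : AugState S N}
    (h : M.occupancy π x ≠ 0) : M.visits π x ≠ 0 := fun h0 => h (by
  rw [occupancy_eq, h0, mul_zero])

theorem continuous_expect {Θ : Type*} [TopologicalSpace Θ] {π : Θ → Policy S A N}
    (hπ : ∀ x a, Continuous fun θ => π θ x a) (n : ℕ) {F : Θ → AugState S N → A → ℝ}
    (hF : ∀ x a, Continuous fun θ => F θ x a) : Continuous fun θ => M.expect (π θ) n (F θ) := by
  induction n generalizing F with
  | zero =>
    simp only [expect]
    fun_prop
  | succ n ih =>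
    refine ih fun x a => ?_
    simp only [trans]
    fun_prop

theorem continuous_visits {Θ : Type*} [TopologicalSpace Θ] {π : Θ → Policy S A N}
    (hπ : ∀ x a, Continuous fun θ => π θ x a) (x : AugState S N) :
    Continuous fun θ => M.visits (π θ) x := by
  rcases M.visits_eq x with ⟨n, h⟩ | h
  · simp only [fun θ => (h (π θ)).tsum_eq, visits]
    exact M.continuous_expect hπ n fun _ _ => continuous_const
  · simp only [fun θ => (h (π θ)).tsum_eq, visits]
    exact continuous_const

/-- Up to time `n` the policy acts `n + 1` times, and each action costs one factor `c`. -/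
theorem expect_le_of_le (π π' : Policy S A N) {c : ℝ} (hc : 0 ≤ c)
    (h : ∀ x a, π' x a ≤ c * π x a) (n : ℕ) {F : AugState S N → A → ℝ}
    (hF : ∀ x a, 0 ≤ F x a) : M.expect π' n F ≤ c ^ (n + 1) * M.expect π n F := by
  have key : ∀ (x : AugState S N) (G : A → ℝ), (∀ a, 0 ≤ G a) →
      ∑ a, π' x a * G a ≤ c * ∑ a, π x a * G a := fun x G hG => by
    rw [Finset.mul_sum]
    exact Finset.sum_le_sum fun a _ => by
      rw [← mul_assoc]; exact mul_le_mul_of_nonneg_right (h x a) (hG a)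
  induction n generalizing F with
  | zero =>
    simp only [expect, zero_add, pow_one]
    rw [Finset.mul_sum]
    refine Finset.sum_le_sum fun s _ => ?_
    rw [mul_left_comm]
    exact mul_le_mul_of_nonneg_left (key _ _ (hF _)) (stdSimplex.zero_le _ _)
  | succ n ih =>
    have hT : ∀ x a, M.trans π' F x a ≤ c * M.trans π F x a := fun x a => by
      simp only [trans]
      rw [Finset.mul_sum]
      refine Finset.sum_le_sum fun s _ => ?_
      rw [mul_left_comm]
      exact mul_le_mul_of_nonneg_left (key _ _ (hF _)) (stdSimplex.zero_le _ _)
    have h0 : ∀ x a, 0 ≤ M.trans π' F x a := fun x a => Finset.sum_nonneg fun _ _ =>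
      mul_nonneg (stdSimplex.zero_le _ _) (Finset.sum_nonneg fun _ _ =>
        mul_nonneg (stdSimplex.zero_le _ _) (hF _ _))
    calc M.expect π' (n + 1) F ≤ c ^ (n + 1) * M.expect π n (M.trans π' F) := ih h0
      _ ≤ c ^ (n + 1) * M.expect π n (fun x a => c * M.trans π F x a) :=
          mul_le_mul_of_nonneg_left (M.expect_mono π n hT) (by positivity)
      _ = _ := by rw [expect_mul_left]; simp only [expect]; ring

/-- A policy of larger support visits more augmented states. -/
theorem visits_eq_zero_of_le (π π' : Policy S A N) {c : ℝ} (hc : 0 ≤ c)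
    (h : ∀ x a, π' x a ≤ c * π x a) {x : AugState S N} (hx : M.visits π x = 0) :
    M.visits π' x = 0 := by
  have h0 := (M.hasSum_visits π x)
  rw [hx, hasSum_zero_iff_of_nonneg (M.visit_nonneg π x)] at h0
  rw [visits]
  refine (tsum_congr fun n => le_antisymm ?_ (M.visit_nonneg π' x n)).trans tsum_zero
  have := M.expect_le_of_le π π' hc h n (F := fun y _ => open Classical in if y = x then 1 else 0)
    fun _ _ => by split_ifs <;> norm_num
  refine this.trans_eq ?_
  rw [show M.expect π n _ = 0 from congrFun h0 n, mul_zero]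

/-! #### Values of state-action pairs -/

/-- The value of the pair `(x, a)` under `π` for the reward function `r`. -/
def qValue (π : Policy S A N) (r : AugState S N → A → ℝ) (x : AugState S N) (a : A) : ℝ :=
  ∑' k, ((M.trans π)^[k] r) x a

theorem abs_iterate_trans_le (π : Policy S A N) {r : AugState S N → A → ℝ} {L : ℝ}
    (hr : ∀ x a, |r x a| ≤ L * |x.2.2|) (k : ℕ) (x : AugState S N) (a : A) :
    |((M.trans π)^[k] r) x a| ≤ L * M.γ ^ k * |x.2.2| := by
  induction k generalizing x a with
  | zero => simpa using hr x a
  | succ k ih =>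
    rw [Function.iterate_succ_apply']
    refine (M.abs_trans_le π ih x a).trans_eq ?_
    ring

theorem hasSum_geometric_bound (L b : ℝ) :
    HasSum (fun k => L * M.γ ^ k * b) (L / (1 - M.γ) * b) := by
  rw [div_eq_mul_inv]
  exact ((hasSum_geometric_of_lt_one M.γ_pos.le M.γ_lt_one).mul_left L).mul_right b

theorem hasSum_qValue (π : Policy S A N) {r : AugState S N → A → ℝ} {L : ℝ}
    (hr : ∀ x a, |r x a| ≤ L * |x.2.2|) (x : AugState S N) (a : A) :
    HasSum (fun k => ((M.trans π)^[k] r) x a) (M.qValue π r x a) :=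
  (Summable.of_norm_bounded (M.hasSum_geometric_bound L |x.2.2|).summable
    fun k => M.abs_iterate_trans_le π hr k x a).hasSum

theorem abs_qValue_le (π : Policy S A N) {r : AugState S N → A → ℝ} {L : ℝ}
    (hr : ∀ x a, |r x a| ≤ L * |x.2.2|) (x : AugState S N) (a : A) :
    |M.qValue π r x a| ≤ L / (1 - M.γ) * |x.2.2| :=
  tsum_of_norm_bounded (f := fun k => ((M.trans π)^[k] r) x a) (M.hasSum_geometric_bound L |x.2.2|)
    fun k => M.abs_iterate_trans_le π hr k x a

/-- The Bellman equation. -/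
theorem qValue_eq (π : Policy S A N) {r : AugState S N → A → ℝ} {L : ℝ}
    (hr : ∀ x a, |r x a| ≤ L * |x.2.2|) (x : AugState S N) (a : A) :
    r x a = M.qValue π r x a - M.trans π (M.qValue π r) x a := by
  have h1 : HasSum (fun k => ((M.trans π)^[k + 1] r) x a) (M.trans π (M.qValue π r) x a) := by
    simp only [Function.iterate_succ_apply']
    exact hasSum_sum fun s' _ => (hasSum_sum fun a' _ =>
      (M.hasSum_qValue π hr _ _).mul_left _).mul_left _
  have h2 := (hasSum_nat_add_iff' 1).2 (M.hasSum_qValue π hr x a)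
  have h3 := h1.unique h2
  simp only [Finset.range_one, Finset.sum_singleton, Function.iterate_zero, id_eq] at h3
  linarith

/-- `J π - c` is the expected total reward for the reward function `r`, which decays along
trajectories. -/
structure IsAdditive (J : Policy S A N → ℝ) (r : AugState S N → A → ℝ) (c L : ℝ) : Prop where
  bound : ∀ x a, |r x a| ≤ L * |x.2.2|
  tendsto : ∀ π, Tendsto (fun n => ∑ k ∈ Finset.range n, M.expect π k r) atTop (𝓝 (J π - c))

variable {M} {J : Policy S A N → ℝ} {r : AugState S N → A → ℝ} {c L : ℝ}

theorem tendsto_expect_zero (π : Policy S A N) {F : AugState S N → A → ℝ} {c : ℝ}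
    (h : ∀ x a, |F x a| ≤ c * |x.2.2|) : Tendsto (fun n => M.expect π n F) atTop (𝓝 0) := by
  have : Tendsto (fun n => c * M.γ ^ n) atTop (𝓝 (c * 0)) :=
    (tendsto_pow_atTop_nhds_zero_of_lt_one M.γ_pos.le M.γ_lt_one).const_mul c
  rw [mul_zero] at this
  exact squeeze_zero_norm (fun n => M.abs_expect_le π n h) this

/-- By the Bellman equation the partial sums telescope, and the remainder vanishes because `qValue`
is bounded by a multiple of `|b|`. -/
theorem IsAdditive.eq_expect (hJ : M.IsAdditive J r c L) (π : Policy S A N) :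
    J π - c = M.expect π 0 (M.qValue π r) := by
  have h1 : ∀ n, ∑ k ∈ Finset.range n, M.expect π k r =
      M.expect π 0 (M.qValue π r) - M.expect π n (M.qValue π r) := fun n => by
    rw [← Finset.sum_range_sub' (fun k => M.expect π k (M.qValue π r))]
    refine Finset.sum_congr rfl fun k _ => ?_
    rw [show M.expect π (k + 1) (M.qValue π r) = M.expect π k (M.trans π (M.qValue π r)) from rfl,
      ← expect_sub]
    congr 1
    funext x a
    exact M.qValue_eq π hJ.bound x a
  have h2 := hJ.tendsto π
  simp only [h1] at h2
  have h3 := (tendsto_expect_zero (M := M) π (M.abs_qValue_le π hJ.bound)).const_sub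
    (M.expect π 0 (M.qValue π r))
  rw [sub_zero] at h3
  exact tendsto_nhds_unique h2 h3

theorem expect_eq_sum_visit (π : Policy S A N) (n : ℕ) (T : Finset (AugState S N))
    {G : AugState S N → ℝ} (hG : ∀ x, x ∉ T → G x = 0) :
    M.expect π n (fun x _ => G x) = ∑ x ∈ T, G x * M.visit π x n := by
  classical
  simp only [visit, ← expect_mul_left]
  rw [← expect_sum]
  congr 1
  funext y _
  simp only [mul_ite, mul_one, mul_zero, Finset.sum_ite_eq]
  split_ifs with h
  · rfl
  · exact hG y h

/-- The performance difference identity. -/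
theorem IsAdditive.sub_eq (hJ : M.IsAdditive J r c L) {T : Finset (AugState S N)}
    {π π' : Policy S A N} (hT : ∀ x, x ∉ T → π' x = π x) :
    J π' - J π = ∑ x ∈ T, M.visits π' x * ∑ a, (π' x a - π x a) * M.qValue π r x a := by
  set Q := M.qValue π r with hQ
  set V : AugState S N → ℝ := fun x => ∑ a, π x a * Q x a with hV
  set G : AugState S N → ℝ := fun x => ∑ a, (π' x a - π x a) * Q x a with hG
  have hG0 : ∀ x, x ∉ T → G x = 0 := fun x hx => by simp [hG, hT x hx]
  -- Under `π'`, write `r` as `Q - V` plus `V` minus its successor value. The first part averages to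
  -- `G`; the second telescopes in `k`, since `V` already averages over `π` and so `trans π' V =
  -- trans π Q`.
  have h1 : ∀ k, M.expect π' k r = ∑ x ∈ T, G x * M.visit π' x k +
      (M.expect π' k (fun x _ => V x) - M.expect π' (k + 1) (fun x _ => V x)) := fun k => by
    have e1 : M.expect π' (k + 1) (fun x _ => V x) = M.expect π' k (M.trans π Q) := by
      rw [← M.trans_state π π']; rfl
    have e2 : M.expect π' k Q - M.expect π' k (fun x _ => V x) =
        ∑ x ∈ T, G x * M.visit π' x k := by
      rw [← expect_eq_sum_visit π' k T hG0, ← M.expect_average π' k Q, ← expect_sub]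
      congr 1
      funext x _
      simp only [hG, hV, sub_mul, Finset.sum_sub_distrib]
    have e3 : M.expect π' k r = M.expect π' k Q - M.expect π' k (M.trans π Q) := by
      rw [← expect_sub]
      congr 1
      funext x a
      exact M.qValue_eq π hJ.bound x a
    rw [e1, e3, ← e2]
    ring
  have h2 : ∀ n, ∑ k ∈ Finset.range n, M.expect π' k r =
      ∑ x ∈ T, G x * ∑ k ∈ Finset.range n, M.visit π' x k +
        (M.expect π' 0 (fun x _ => V x) - M.expect π' n (fun x _ => V x)) := fun n => by
    simp only [h1, Finset.sum_add_distrib, Finset.mul_sum]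
    rw [Finset.sum_range_sub' (fun k => M.expect π' k (fun x _ => V x)), Finset.sum_comm]
  have hVb : ∀ (x : AugState S N) (a : A), |V x| ≤ L / (1 - M.γ) * |x.2.2| := fun x _ => by
    calc |V x| ≤ ∑ a, π x a * (L / (1 - M.γ) * |x.2.2|) :=
          (Finset.abs_sum_le_sum_abs _ _).trans (Finset.sum_le_sum fun a _ => by
            rw [abs_mul, abs_of_nonneg (stdSimplex.zero_le _ _)]
            exact mul_le_mul_of_nonneg_left (M.abs_qValue_le π hJ.bound x a)
              (stdSimplex.zero_le _ _))
      _ = _ := by rw [← Finset.sum_mul, stdSimplex.sum_eq_one, one_mul]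
  have h3 : Tendsto (fun n => ∑ k ∈ Finset.range n, M.expect π' k r) atTop
      (𝓝 (∑ x ∈ T, G x * M.visits π' x + (M.expect π' 0 (fun x _ => V x) - 0))) := by
    simp only [h2]
    exact (tendsto_finsetSum _ fun x _ =>
      ((M.hasSum_visits π' x).tendsto_sum_nat.const_mul (G x))).add
        ((tendsto_expect_zero (M := M) π' (F := fun x _ => V x) hVb).const_sub _)
  have h4 := tendsto_nhds_unique (hJ.tendsto π') h3
  have h5 := hJ.eq_expect π
  have h6 : M.expect π' 0 (fun x _ => V x) = M.expect π 0 Q := by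
    simp only [expect, hV, ← Finset.sum_mul, stdSimplex.sum_eq_one, one_mul]
  rw [h6, ← h5] at h4
  calc J π' - J π = ∑ x ∈ T, G x * M.visits π' x := by linarith
    _ = _ := Finset.sum_congr rfl fun x _ => mul_comm _ _

theorem IsAdditive.abs_sub_le (hJ : M.IsAdditive J r c L) (π : Policy S A N) :
    |J π - c| ≤ L / (1 - M.γ) := by
  rw [hJ.eq_expect π]
  simpa using M.abs_expect_le π 0 (M.abs_qValue_le π hJ.bound)

/-- The performance difference identity based at a fixed `θ₀` involves only the values of `π θ₀`, so
no continuity of `qValue` in the policy is required. -/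
theorem IsAdditive.continuous (hJ : M.IsAdditive J r c L) {T : Finset (AugState S N)}
    {Θ : Type*} [TopologicalSpace Θ] {π : Θ → Policy S A N}
    (hπ : ∀ x a, Continuous fun θ => π θ x a) (hT : ∀ θ θ' x, x ∉ T → π θ x = π θ' x) :
    Continuous fun θ => J (π θ) := by
  refine continuous_iff_continuousAt.2 fun θ₀ => ?_
  have h : (fun θ => J (π θ)) = fun θ => J (π θ₀) +
      ∑ x ∈ T, M.visits (π θ) x * ∑ a, (π θ x a - π θ₀ x a) * M.qValue (π θ₀) r x a := by
    funext θ
    rw [← hJ.sub_eq (hT θ θ₀)]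
    ring
  rw [h]
  have hv := M.continuous_visits hπ
  fun_prop

/-! #### Expected total rewards -/

theorem abs_aug_le (ω : ℕ → Step S A) (n : ℕ) : |(M.aug ω n).2.2| = M.γ ^ n :=
  abs_of_pos (pow_pos M.γ_pos n)

theorem summable_rewards {r : AugState S N → A → S → ℝ} {L : ℝ}
    (hr : ∀ x a s', |r x a s'| ≤ L * |x.2.2|) (ω : ℕ → Step S A) :
    Summable fun k => r (M.aug ω k) (ω k).a (ω (k + 1)).s :=
  Summable.of_norm_bounded (M.hasSum_geometric_bound L 1).summable fun k => by
    simpa [abs_aug_le] using hr (M.aug ω k) (ω k).a (ω (k + 1)).s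

/-- The expectation of a constant plus a total reward is an additive objective. -/
theorem isAdditive_integral {r : AugState S N → A → S → ℝ} {L : ℝ}
    (hr : ∀ x a s', |r x a s'| ≤ L * |x.2.2|) {f : (ℕ → Step S A) → ℝ} {c₀ : ℝ}
    (hf : ∀ ω, f ω = c₀ + ∑' k, r (M.aug ω k) (ω k).a (ω (k + 1)).s) (c₁ : ℝ) :
    M.IsAdditive (fun π => (∫ ω, f ω ∂(M.law π)) + c₁)
      (fun x a => ∑ s', M.P x.1 a s' * r x a s') (c₀ + c₁) L := by
  refine ⟨fun x a => ?_, fun π => ?_⟩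
  · calc _ ≤ ∑ s', M.P x.1 a s' * (L * |x.2.2|) :=
          (Finset.abs_sum_le_sum_abs _ _).trans (Finset.sum_le_sum fun s' _ => by
            rw [abs_mul, abs_of_nonneg (stdSimplex.zero_le _ _)]
            exact mul_le_mul_of_nonneg_left (hr x a s') (stdSimplex.zero_le _ _))
      _ = _ := by rw [← Finset.sum_mul, stdSimplex.sum_eq_one, one_mul]
  · have hm : ∀ k, Measurable fun ω : ℕ → Step S A => r (M.aug ω k) (ω k).a (ω (k + 1)).s :=
      fun k => measurable_of_past (n := k + 1) fun ω ω' h => by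
        rw [M.aug_congr (fun j hj => h j (by omega)) (by rw [h k (by omega)]), h k (by omega),
          h (k + 1) le_rfl]
    have hb : ∀ k (ω : ℕ → Step S A), ‖r (M.aug ω k) (ω k).a (ω (k + 1)).s‖ ≤ L * M.γ ^ k :=
      fun k ω => by simpa [abs_aug_le] using hr (M.aug ω k) (ω k).a (ω (k + 1)).s
    have hi : ∀ k, Integrable (fun ω : ℕ → Step S A => r (M.aug ω k) (ω k).a (ω (k + 1)).s)
        (M.law π) := fun k =>
      Integrable.of_bound (hm k).aestronglyMeasurable (L * M.γ ^ k) (.of_forall (hb k))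
    have hg : Summable fun k => L * M.γ ^ k := by
      simpa using (M.hasSum_geometric_bound L 1).summable
    have hs := hasSum_integral_of_summable_integral_norm hi
      (Summable.of_nonneg_of_le (fun k => integral_nonneg fun _ => norm_nonneg _) (fun k => by
        refine (integral_mono (hi k).norm (integrable_const (L * M.γ ^ k)) (hb k)).trans_eq ?_
        simp) hg)
    have hint : Integrable (fun ω => ∑' k, r (M.aug ω k) (ω k).a (ω (k + 1)).s) (M.law π) := by
      refine Integrable.of_bound (C := ∑' k, L * M.γ ^ k) ?_ ?_
      · exact (Measurable.aestronglyMeasurable (Measurable.tsum hm))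
      · exact .of_forall fun ω => tsum_of_norm_bounded hg.hasSum fun k => hb k ω
    simp only [hf]
    rw [integral_add (integrable_const _) hint]
    simp only [integral_const, probReal_univ, smul_eq_mul, one_mul]
    rw [show ∀ I : ℝ, c₀ + I + c₁ - (c₀ + c₁) = I from fun I => by ring]
    simpa only [integral_reward] using hs.tendsto_sum_nat

end CMDP

/-! ### The objectives of the risk-constrained problem are additive -/

namespace DiscreteSpectrum

variable {m : ℕ} (σ : DiscreteSpectrum m)

/-- A Lipschitz constant of `g_β`. -/
def gLip : ℝ := |σ.η 0| + ∑ j : Fin m, |σ.η j.succ - σ.η j.castSucc|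

theorem abs_g_sub_le (β : Fin m → ℝ) (x y : ℝ) : |σ.g β x - σ.g β y| ≤ σ.gLip * |x - y| := by
  have h : σ.g β x - σ.g β y = σ.η 0 * (x - y) + ∑ j : Fin m,
      (σ.η j.succ - σ.η j.castSucc) * (max (x - β j) 0 - max (y - β j) 0) := by
    simp only [g, mul_sub, Finset.sum_sub_distrib]
    ring
  rw [h, gLip, add_mul, Finset.sum_mul]
  refine (abs_add_le _ _).trans (add_le_add (abs_mul _ _).le ?_)
  refine (Finset.abs_sum_le_sum_abs _ _).trans (Finset.sum_le_sum fun j _ => ?_)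
  rw [abs_mul]
  refine mul_le_mul_of_nonneg_left ?_ (abs_nonneg _)
  simpa using abs_max_sub_max_le_abs (x - β j) (y - β j) 0

theorem gLip_nonneg : 0 ≤ σ.gLip :=
  add_nonneg (abs_nonneg _) (Finset.sum_nonneg fun _ _ => abs_nonneg _)

theorem continuous_g (β : Fin m → ℝ) : Continuous (σ.g β) := by
  unfold g
  fun_prop

end DiscreteSpectrum

namespace CMDP

variable {S A : Type*} [Fintype S] [Fintype A] {N : ℕ} (M : CMDP S A N)

theorem isAdditive_JR : ∃ r c L, M.IsAdditive M.JR r c L := by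
  have h := M.isAdditive_integral (r := fun x a s' => x.2.2 * M.R x.1 a s') (L := |M.Rmax|)
    (f := M.returnR) (c₀ := 0) ?_ (fun ω => ?_) 0
  · simp only [add_zero] at h
    exact ⟨_, _, _, h⟩
  · intro x a s'
    rw [abs_mul, mul_comm]
    exact mul_le_mul_of_nonneg_right ((M.abs_R_le _ _ _).trans (le_abs_self _)) (abs_nonneg _)
  · rw [zero_add]; rfl

theorem abs_C_le (i : Fin N) (s : S) (a : A) (s' : S) : |M.C i s a s'| ≤ |M.Cmax| := by
  rw [abs_of_nonneg (M.C_nonneg i s a s')]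
  exact (M.C_le i s a s').trans (le_abs_self _)

/-- This is the purpose of the component `e`: the product of `b` and `e` is the discounted cost paid
so far. -/
theorem sum_cost (ω : ℕ → Step S A) (i : Fin N) (n : ℕ) :
    ∑ k ∈ Finset.range n, M.γ ^ k * M.C i (ω k).s (ω k).a (ω (k + 1)).s =
      M.γ ^ n * M.accCost ω i n := by
  induction n with
  | zero => simp [accCost]
  | succ n ih =>
    rw [Finset.sum_range_succ, ih, accCost]
    have := M.γ_pos.ne'
    field_simp
    ring

theorem tendsto_returnC (ω : ℕ → Step S A) (i : Fin N) :
    Tendsto (fun n => M.γ ^ n * M.accCost ω i n) atTop (𝓝 (M.returnC i ω)) := by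
  have hs : Summable fun k => M.γ ^ k * M.C i (ω k).s (ω k).a (ω (k + 1)).s :=
    Summable.of_norm_bounded (M.hasSum_geometric_bound |M.Cmax| 1).summable fun k => by
      rw [Real.norm_eq_abs, abs_mul, abs_of_pos (pow_pos M.γ_pos k), mul_one, mul_comm]
      exact mul_le_mul_of_nonneg_right (M.abs_C_le _ _ _ _) (pow_pos M.γ_pos k).le
  have := hs.hasSum.tendsto_sum_nat
  simp only [sum_cost] at this
  exact this

end CMDP

namespace RCProblem

variable {S A : Type*} [Fintype S] [Fintype A] {N m : ℕ} (M : RCProblem S A N m)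

/-- The nonlinear function `g` of the return becomes additive by telescoping `g` along the
discounted cost paid so far. Its increment in one step is a function of the augmented state, action
and next state, and is bounded by a multiple of `|b|` since `g` is Lipschitz. The conjugate integral
does not depend on the policy and enters the constant. -/
theorem isAdditive_JC (β : DualParam N m) (i : Fin N) :
    ∃ r c L, M.toCMDP.IsAdditive (M.JC β i) r c L := by
  set g := (M.σ i).g (β i) with hg
  set r : AugState S N → A → S → ℝ := fun x a s' =>
    g (x.2.2 * (M.C i x.1 a s' + x.2.1 i)) - g (x.2.2 * x.2.1 i) with hr
  set L := (M.σ i).gLip * |M.Cmax| with hL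
  have hrL : ∀ x a s', |r x a s'| ≤ L * |x.2.2| := fun x a s' => by
    refine ((M.σ i).abs_g_sub_le (β i) _ _).trans ?_
    rw [← mul_sub, add_sub_cancel_right, abs_mul, hL, mul_assoc, mul_comm |M.Cmax|]
    exact mul_le_mul_of_nonneg_left (mul_le_mul_of_nonneg_left (M.abs_C_le _ _ _ _)
      (abs_nonneg _)) (M.σ i).gLip_nonneg
  refine ⟨_, _, L, M.toCMDP.isAdditive_integral (r := r) (c₀ := g 0) hrL (fun ω => ?_) _⟩
  have hpart : ∀ n, ∑ k ∈ Finset.range n, r (M.aug ω k) (ω k).a (ω (k + 1)).s =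
      g (M.γ ^ n * M.accCost ω i n) - g 0 := fun n => by
    have h0 : M.γ ^ 0 * M.accCost ω i 0 = 0 := by simp [CMDP.accCost]
    rw [← h0, ← Finset.sum_range_sub (fun n => g (M.γ ^ n * M.accCost ω i n))]
    refine Finset.sum_congr rfl fun k _ => ?_
    simp only [hr, CMDP.aug, CMDP.accCost]
    congr 2
    have := M.γ_pos.ne'
    field_simp
    ring
  have h1 := (M.toCMDP.summable_rewards hrL ω).hasSum.tendsto_sum_nat
  simp only [hpart] at h1
  have h2 := ((((M.σ i).continuous_g (β i)).tendsto _).comp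
    (M.toCMDP.tendsto_returnC ω i)).sub_const (g 0)
  have := tendsto_nhds_unique h1 h2
  linarith

end RCProblem

/-! ### Linear combinations of additive objectives -/

namespace CMDP

variable {S A : Type*} [Fintype S] [Fintype A] {N : ℕ} {M : CMDP S A N}
  {J J' : Policy S A N → ℝ} {r r' : AugState S N → A → ℝ} {c c' L L' : ℝ}

theorem IsAdditive.add (h : M.IsAdditive J r c L) (h' : M.IsAdditive J' r' c' L') :
    M.IsAdditive (fun π => J π + J' π) (fun x a => r x a + r' x a) (c + c') (L + L') := by
  refine ⟨fun x a => ?_, fun π => ?_⟩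
  · rw [add_mul]
    exact (abs_add_le _ _).trans (add_le_add (h.bound x a) (h'.bound x a))
  · have := (h.tendsto π).add (h'.tendsto π)
    simp only [expect_add, Finset.sum_add_distrib]
    rwa [show J π + J' π - (c + c') = J π - c + (J' π - c') by ring]

theorem IsAdditive.const_mul (h : M.IsAdditive J r c L) (k : ℝ) :
    M.IsAdditive (fun π => k * J π) (fun x a => k * r x a) (k * c) (|k| * L) := by
  refine ⟨fun x a => ?_, fun π => ?_⟩
  · rw [abs_mul, mul_assoc]
    exact mul_le_mul_of_nonneg_left (h.bound x a) (abs_nonneg _)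
  · simp only [expect_mul_left, ← Finset.mul_sum, ← mul_sub]
    exact (h.tendsto π).const_mul k

theorem isAdditive_zero : M.IsAdditive (fun _ => 0) (fun _ _ => 0) 0 0 := by
  refine ⟨by simp, fun π => ?_⟩
  have : ∀ n, M.expect π n (fun _ _ => 0) = 0 := fun n => by
    simpa using M.expect_mul_left π n 0 (fun _ _ => 0)
  simp [this]

theorem isAdditive_sum {ι : Type*} (T : Finset ι) {J : ι → Policy S A N → ℝ}
    {r : ι → AugState S N → A → ℝ} {c L : ι → ℝ} (h : ∀ i, M.IsAdditive (J i) (r i) (c i) (L i)) :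
    M.IsAdditive (fun π => ∑ i ∈ T, J i π) (fun x a => ∑ i ∈ T, r i x a)
      (∑ i ∈ T, c i) (∑ i ∈ T, L i) := by
  classical
  induction T using Finset.induction_on with
  | empty => simpa using isAdditive_zero
  | insert i T hi ih =>
    simp only [Finset.sum_insert hi]
    exact (h i).add ih

theorem IsAdditive.mono (h : M.IsAdditive J r c L) (hL : L ≤ L') : M.IsAdditive J r c L' :=
  ⟨fun x a => (h.bound x a).trans (mul_le_mul_of_nonneg_right hL (abs_nonneg _)), h.tendsto⟩

end CMDP

/-! ### Softmax, gradients and natural gradients -/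

theorem softmax_pos {ι : Type*} [Fintype ι] [Nonempty ι] (v : ι → ℝ) (i : ι) :
    0 < softmax v i :=
  div_pos (Real.exp_pos _) (Finset.sum_pos (fun _ _ => Real.exp_pos _) Finset.univ_nonempty)

theorem log_softmax {ι : Type*} [Fintype ι] [Nonempty ι] (v : ι → ℝ) (i : ι) :
    Real.log (softmax v i) = v i - Real.log (∑ j, Real.exp (v j)) := by
  have h : softmax v i = Real.exp (v i) / ∑ j, Real.exp (v j) := rfl
  rw [h, Real.log_div (Real.exp_pos _).ne'
    (Finset.sum_pos (fun j _ => Real.exp_pos _) Finset.univ_nonempty).ne', Real.log_exp]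

section

variable {E : Type*} [NormedAddCommGroup E] [NormedSpace ℝ E] {ι : Type*} [Fintype ι] [Nonempty ι]

/-- The derivative of `v ↦ log (softmax (ℓ v) i)`. -/
def softmaxScore (ℓ : ι → E →L[ℝ] ℝ) (v : E) (i : ι) : E →L[ℝ] ℝ :=
  ℓ i - ∑ j, softmax (fun k => ℓ k v) j • ℓ j

theorem hasFDerivAt_log_softmax (ℓ : ι → E →L[ℝ] ℝ) (v : E) (i : ι) :
    HasFDerivAt (fun v => Real.log (softmax (fun k => ℓ k v) i)) (softmaxScore ℓ v i) v := by
  simp only [log_softmax]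
  have h1 : HasFDerivAt (fun v => ∑ j, Real.exp (ℓ j v)) (∑ j, Real.exp (ℓ j v) • ℓ j) v :=
    HasFDerivAt.fun_sum fun j _ => (ℓ j).hasFDerivAt.exp
  have h2 := (ℓ i).hasFDerivAt.sub
    (h1.log (Finset.sum_pos (fun j _ => Real.exp_pos (ℓ j v)) Finset.univ_nonempty).ne')
  refine h2.congr_fderiv ?_
  rw [softmaxScore, Finset.smul_sum]
  congr 1
  refine Finset.sum_congr rfl fun j _ => ?_
  rw [smul_smul, mul_comm, ← div_eq_mul_inv]
  rfl

theorem hasFDerivAt_softmax (ℓ : ι → E →L[ℝ] ℝ) (v : E) (i : ι) :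
    HasFDerivAt (fun v => softmax (fun k => ℓ k v) i)
      (softmax (fun k => ℓ k v) i • softmaxScore ℓ v i) v := by
  have h := (hasFDerivAt_log_softmax ℓ v i).exp
  simpa only [Real.exp_log (softmax_pos _ _)] using h

theorem sum_softmaxScore (ℓ : ι → E →L[ℝ] ℝ) (v z : E) :
    ∑ i, softmax (fun k => ℓ k v) i * softmaxScore ℓ v i z = 0 := by
  simp only [softmaxScore, sub_apply, sum_apply, smul_apply, smul_eq_mul, mul_sub,
    Finset.sum_sub_distrib,
    ← Finset.sum_mul, stdSimplex.sum_eq_one, one_mul, sub_self]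

/-- Where one factor vanishes, the product rule needs only continuity of the other. This gives the
policy gradient without differentiating the visits. -/
theorem hasFDerivAt_mul_of_eq_zero {f h : E → ℝ} {h' : E →L[ℝ] ℝ} {v : E}
    (hh : HasFDerivAt h h' v) (hf : ContinuousAt f v) (h0 : h v = 0) :
    HasFDerivAt (fun w => f w * h w) (f v • h') v := by
  have h1 : HasFDerivAt (fun w => (f w - f v) * h w) (0 : E →L[ℝ] ℝ) v := by
    rw [hasFDerivAt_iff_isLittleO]
    have ho : (fun w => f w - f v) =o[𝓝 v] (fun _ => (1 : ℝ)) := by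
      rw [Asymptotics.isLittleO_one_iff]
      simpa using hf.sub_const (f v)
    have hO : h =O[𝓝 v] fun w => w - v := by
      simpa [h0] using hh.isBigO_sub
    have := (ho.mul_isBigO hO.norm_right)
    simp only [one_mul] at this
    simpa [h0] using this.norm_right
  have h2 := h1.add (hh.const_mul (f v))
  rw [zero_add] at h2
  refine h2.congr_of_eventuallyEq (.of_forall fun w => ?_)
  simp only [Pi.add_apply]
  ring

end

theorem sum_gradient_mul {n : Type*} [Fintype n] {f : EuclideanSpace ℝ n → ℝ}
    {f' : EuclideanSpace ℝ n →L[ℝ] ℝ} {θ : EuclideanSpace ℝ n} (h : HasFDerivAt f f' θ)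
    (z : EuclideanSpace ℝ n) : ∑ i, gradient f θ i * z i = f' z := by
  have h1 : inner ℝ (gradient f θ) z = f' z := by
    rw [gradient, h.fderiv, InnerProductSpace.toDual_symm_apply]
  rw [← h1, PiLp.inner_apply]
  refine Finset.sum_congr rfl fun i _ => ?_
  simp [mul_comm]

/-- If the gradient `G` equals `F w` for a Fisher matrix `F`, then the natural gradient `F† G`
agrees with `w` up to the kernel of all scores of positive weight. -/
theorem naturalGradient_eq {n κ : Type*} [Fintype n] (T : Finset κ) {p : κ → ℝ}
    (hp : ∀ k, 0 ≤ p k) (s : κ → n → ℝ) {G w : n → ℝ}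
    (hG : ∀ z : n → ℝ, ∑ i, G i * z i =
      ∑ k ∈ T, p k * (∑ i, s k i * w i) * (∑ i, s k i * z i)) {k : κ} (hk : k ∈ T)
    (hpk : p k ≠ 0) :
    ∑ i, s k i * ((pinv (∑ k ∈ T, p k • Matrix.vecMulVec (s k) (s k))).mulVec G) i =
      ∑ i, s k i * w i := by
  classical
  set F : Matrix n n ℝ := ∑ k ∈ T, p k • Matrix.vecMulVec (s k) (s k) with hF
  have hsymm : F.transpose = F := by
    simp only [hF, Matrix.transpose_sum, Matrix.transpose_smul, Matrix.transpose_vecMulVec]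
  have hmul : ∀ z i, F.mulVec z i = ∑ k ∈ T, p k * (∑ j, s k j * z j) * s k i := fun z i => by
    simp only [hF, Matrix.mulVec, dotProduct, Matrix.sum_apply, Matrix.smul_apply,
      Matrix.vecMulVec_apply, smul_eq_mul, Finset.sum_mul, Finset.mul_sum]
    rw [Finset.sum_comm]
    exact Finset.sum_congr rfl fun _ _ => Finset.sum_congr rfl fun _ _ => by ring
  have hGw : G = F.mulVec w := by
    funext i
    have h := hG (Pi.single i 1)
    simp only [Pi.single_apply, mul_ite, mul_one, mul_zero, Finset.sum_ite_eq', Finset.mem_univ,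
      if_true] at h
    rw [h, hmul]
  set u := (pinv F).mulVec G with hu
  -- Of the Penrose equations only `F F† F = F` is used. The difference `u - w` is then in the
  -- kernel of `F`, so its quadratic form, a sum of nonnegative terms, vanishes term by term.
  have hFu : F.mulVec u = F.mulVec w := by
    rw [hu, hGw, Matrix.mulVec_mulVec, Matrix.mulVec_mulVec,
      (isMoorePenrose_pinv hsymm).mul_mul_self]
  have hz : F.mulVec (u - w) = 0 := by rw [Matrix.mulVec_sub, hFu, sub_self]
  have hq : ∑ k ∈ T, p k * (∑ j, s k j * (u - w) j) ^ 2 = 0 := by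
    calc _ = ∑ i, F.mulVec (u - w) i * (u - w) i := by
          simp only [hmul, Finset.sum_mul]
          rw [Finset.sum_comm]
          refine Finset.sum_congr rfl fun k _ => ?_
          simp only [mul_assoc, ← Finset.mul_sum, pow_two]
      _ = 0 := by simp [hz]
  rw [Finset.sum_eq_zero_iff_of_nonneg (fun k _ => mul_nonneg (hp k) (sq_nonneg _))] at hq
  have h0 := pow_eq_zero_iff (two_ne_zero) |>.1 ((mul_eq_zero.1 (hq k hk)).resolve_left hpk)
  simp only [Pi.sub_apply, mul_sub, Finset.sum_sub_distrib] at h0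
  linarith

/-! ### One natural policy gradient step -/

/-- One step of exponential weights: the shift `k` cancels in the normalization, and the
log-partition term is controlled by `log y ≤ y - 1` and `exp x ≤ 1 + x + x²` for `|x| ≤ 1`. -/
theorem softmax_step {ι : Type*} [Fintype ι] [Nonempty ι] (p : stdSimplex ℝ ι) (v u w : ι → ℝ)
    {α W k : ℝ} (hα : 0 ≤ α) (hW : ∀ i, |w i| ≤ W) (hαW : α * W ≤ 1) (hu : ∀ i, u i = w i + k) :
    ∑ i, p i * -Real.log (softmax (fun j => v j + α * u j) i) ≤
      ∑ i, p i * -Real.log (softmax v i) - α * ∑ i, (p i - softmax v i) * w i + (α * W) ^ 2 := by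
  set q := softmax v with hq
  have hS : 0 < ∑ j, Real.exp (v j) :=
    Finset.sum_pos (fun _ _ => Real.exp_pos _) Finset.univ_nonempty
  have hqe : 0 < ∑ i, q i * Real.exp (α * w i) :=
    Finset.sum_pos (fun i _ => mul_pos (softmax_pos v i) (Real.exp_pos _)) Finset.univ_nonempty
  have hsum : ∑ j, Real.exp (v j + α * u j) =
      Real.exp (α * k) * ((∑ j, Real.exp (v j)) * ∑ i, q i * Real.exp (α * w i)) := by
    rw [Finset.mul_sum, Finset.mul_sum]
    refine Finset.sum_congr rfl fun i _ => ?_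
    have : q i = Real.exp (v i) / ∑ j, Real.exp (v j) := rfl
    rw [this, hu, mul_add, Real.exp_add, Real.exp_add]
    field_simp
  have hlog : Real.log (∑ i, q i * Real.exp (α * w i)) ≤ α * ∑ i, q i * w i + (α * W) ^ 2 := by
    have h1 : ∀ i, Real.exp (α * w i) ≤ 1 + α * w i + (α * W) ^ 2 := fun i => by
      have hle : |α * w i| ≤ α * W := by
        rw [abs_mul, abs_of_nonneg hα]
        exact mul_le_mul_of_nonneg_left (hW i) hα
      have h2 := (abs_le.1 (Real.abs_exp_sub_one_sub_id_le (hle.trans hαW))).2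
      have h3 : (α * w i) ^ 2 ≤ (α * W) ^ 2 := sq_le_sq' (by linarith [(abs_le.1 hle).1])
        (abs_le.1 hle).2
      linarith
    calc _ ≤ ∑ i, q i * Real.exp (α * w i) - 1 := Real.log_le_sub_one_of_pos hqe
      _ ≤ ∑ i, q i * (1 + α * w i + (α * W) ^ 2) - 1 := by
          gcongr with i
          · exact stdSimplex.zero_le _ _
          · exact h1 i
      _ = _ := by
          simp only [mul_add, mul_one, Finset.sum_add_distrib, ← Finset.sum_mul,
            stdSimplex.sum_eq_one, Finset.mul_sum, one_mul]
          rw [show ∑ i, q i * (α * w i) = ∑ i, α * (q i * w i) from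
            Finset.sum_congr rfl fun _ _ => by ring]
          ring
  have hi : ∀ i, -Real.log (softmax (fun j => v j + α * u j) i) =
      -Real.log (q i) - α * w i + Real.log (∑ i, q i * Real.exp (α * w i)) := fun i => by
    rw [log_softmax, hq, log_softmax, hsum, Real.log_mul (Real.exp_pos _).ne'
      (mul_pos hS hqe).ne', Real.log_mul hS.ne' hqe.ne', Real.log_exp, hu]
    ring
  have hsplit : ∑ i, p i * -Real.log (softmax (fun j => v j + α * u j) i) =
      ∑ i, p i * -Real.log (q i) - α * ∑ i, p i * w i +
        Real.log (∑ i, q i * Real.exp (α * w i)) := by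
    simp only [hi, mul_add, mul_sub, Finset.sum_add_distrib, Finset.sum_sub_distrib,
      ← Finset.sum_mul, stdSimplex.sum_eq_one, one_mul, Finset.mul_sum]
    congr 2
    exact Finset.sum_congr rfl fun _ _ => by ring
  rw [hsplit]
  simp only [sub_mul, Finset.sum_sub_distrib]
  linarith

namespace RCProblem

variable {S A : Type*} [Fintype S] [Fintype A] [Nonempty A] {N m : ℕ} (M : RCProblem S A N m)

/-- The coordinate functionals of the policy parameters at `x`. -/
def coord (x : M.table) (a : A) : M.Param →L[ℝ] ℝ := EuclideanSpace.proj (x, a)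

theorem policy_apply (θ : M.Param) (x : M.table) :
    M.policy θ x = softmax (fun a => M.coord x a θ) := by
  rw [policy, dif_pos x.2]
  rfl

theorem policy_default (θ : M.Param) {x : AugState S N} (hx : x ∉ M.table) :
    M.policy θ x = M.default x := by
  rw [policy, dif_neg hx]

theorem policy_mem (θ : M.Param) : M.policy θ ∈ M.policies := fun _ => M.policy_default θ

theorem policy_pos (θ : M.Param) (x : M.table) (a : A) : 0 < M.policy θ x a := by
  rw [policy_apply]
  exact softmax_pos _ _

theorem continuous_policy (x : AugState S N) (a : A) : Continuous fun θ => M.policy θ x a := by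
  by_cases hx : x ∈ M.table
  · have h : (fun θ => M.policy θ x a) =
        fun θ => softmax (fun a => M.coord ⟨x, hx⟩ a θ) a :=
      funext fun θ => by rw [← policy_apply]
    rw [h]
    exact continuous_iff_continuousAt.2 fun θ => (hasFDerivAt_softmax _ θ a).continuousAt
  · simp only [M.policy_default _ hx]
    exact continuous_const

theorem sum_score (θ : M.Param) (x : M.table) (a : A) (z : M.Param) :
    ∑ i, M.score θ x a i * z i = softmaxScore (M.coord x) θ a z := by
  refine sum_gradient_mul ?_ z
  simp only [policy_apply]
  exact hasFDerivAt_log_softmax _ _ _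

theorem softmaxScore_coord (θ : M.Param) (x : M.table) (a : A) (z : M.Param) :
    softmaxScore (M.coord x) θ a z = z (x, a) - ∑ b, M.policy θ x b * z (x, b) := by
  simp only [softmaxScore, sub_apply, sum_apply, smul_apply, smul_eq_mul, policy_apply]
  rfl

variable {M} {J : Policy S A N → ℝ} {r : AugState S N → A → ℝ} {c L : ℝ}

/-- Softmax policies have full support on the table, so a constant multiple of `π_θ` dominates every
admissible policy. -/
theorem visits_policy_ne_zero (θ : M.Param) {π' : Policy S A N} (hπ' : π' ∈ M.policies)
    {x : AugState S N} (hx : M.visits π' x ≠ 0) : M.visits (M.policy θ) x ≠ 0 := by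
  intro h
  -- The sum dominates each inverse probability on the table; the summand `1` covers the states
  -- outside, where both policies equal `default`.
  set k := 1 + ∑ y : M.table, ∑ a, (M.policy θ y a)⁻¹ with hk
  have hnn : ∀ (y : M.table) (a : A), 0 ≤ (M.policy θ y a)⁻¹ := fun y a =>
    inv_nonneg.2 (stdSimplex.zero_le _ _)
  have hsum : 0 ≤ ∑ y : M.table, ∑ a, (M.policy θ y a)⁻¹ :=
    Finset.sum_nonneg fun y _ => Finset.sum_nonneg fun a _ => hnn y a
  refine hx (M.visits_eq_zero_of_le (M.policy θ) π' (c := k) (by positivity) (fun y a => ?_) h)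
  by_cases hy : y ∈ M.table
  · have h1 : (M.policy θ y a)⁻¹ ≤ k := by
      calc _ ≤ ∑ a, (M.policy θ y a)⁻¹ := Finset.single_le_sum
            (f := fun a => (M.policy θ y a)⁻¹) (fun a _ => hnn ⟨y, hy⟩ a) (Finset.mem_univ a)
        _ ≤ ∑ y : M.table, ∑ a, (M.policy θ y a)⁻¹ := Finset.single_le_sum
            (f := fun y : M.table => ∑ a, (M.policy θ y a)⁻¹)
            (fun y _ => Finset.sum_nonneg fun a _ => hnn y a) (Finset.mem_univ ⟨y, hy⟩)
        _ ≤ k := by rw [hk]; linarith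
    have hp := M.policy_pos θ ⟨y, hy⟩ a
    calc π' y a ≤ 1 := stdSimplex.le_one _ _
      _ = (M.policy θ y a)⁻¹ * M.policy θ y a := (inv_mul_cancel₀ hp.ne').symm
      _ ≤ _ := mul_le_mul_of_nonneg_right h1 hp.le
  · rw [M.policy_default θ hy, hπ' y hy]
    exact le_mul_of_one_le_left (stdSimplex.zero_le _ _) (by rw [hk]; linarith)

/-- The policy gradient theorem. -/
theorem hasFDerivAt_objective (hJ : M.toCMDP.IsAdditive J r c L) (θ : M.Param) :
    HasFDerivAt (fun θ' => J (M.policy θ')) (∑ x : M.table, M.visits (M.policy θ) x •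
      ∑ a, M.qValue (M.policy θ) r x a • M.policy θ x a • softmaxScore (M.coord x) θ a) θ := by
  have h : (fun θ' => J (M.policy θ')) = fun θ' => (∑ x : M.table, M.visits (M.policy θ') x *
      ∑ a, (M.policy θ' x a - M.policy θ x a) * M.qValue (M.policy θ) r x a) +
      J (M.policy θ) := by
    funext θ'
    have := hJ.sub_eq (T := M.table) (π := M.policy θ) (π' := M.policy θ')
      (fun x hx => by rw [M.policy_default _ hx, M.policy_default _ hx])
    rw [Finset.sum_coe_sort M.table (fun x => M.visits (M.policy θ') x *
      ∑ a, (M.policy θ' x a - M.policy θ x a) * M.qValue (M.policy θ) r x a), ← this]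
    ring
  rw [h]
  refine HasFDerivAt.add_const _ (HasFDerivAt.fun_sum fun x _ => ?_)
  -- The factor next to `visits` vanishes at `θ' = θ`.
  refine hasFDerivAt_mul_of_eq_zero ?_
    (M.continuous_visits (fun x a => M.continuous_policy x a) _).continuousAt (by simp)
  refine HasFDerivAt.fun_sum fun a _ => ?_
  have h1 : HasFDerivAt (fun θ' => M.policy θ' x a)
      (M.policy θ x a • softmaxScore (M.coord x) θ a) θ := by
    simp only [policy_apply]
    exact hasFDerivAt_softmax _ _ _
  exact (h1.sub_const _).mul_const _

variable (M) in
/-- The direction in parameter space that corresponds to `Q`. -/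
def advantage (Q : AugState S N → A → ℝ) : M.Param :=
  WithLp.toLp 2 fun y => Q y.1 y.2 / ((1 - M.γ) * y.1.1.2.2)

/-- At every visited augmented state, the natural policy gradient is the vector of values of
state-action pairs, up to scaling and an additive constant. -/
theorem naturalPolicyGradient_eq (hJ : M.toCMDP.IsAdditive J r c L) (θ : M.Param) {x : M.table}
    (hx : M.visits (M.policy θ) x ≠ 0) (a : A) :
    softmaxScore (M.coord x) θ a (WithLp.toLp 2 ((pinv (M.fisher θ)).mulVec
      (gradient (fun θ' => J (M.policy θ')) θ).ofLp)) =
    softmaxScore (M.coord x) θ a (M.advantage (M.qValue (M.policy θ) r)) := by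
  set Q := M.qValue (M.policy θ) r with hQ
  have hγ : 0 < 1 - M.γ := sub_pos.2 M.γ_lt_one
  have hfisher : M.fisher θ = ∑ y ∈ (Finset.univ : Finset (M.table × A)),
      (M.occupancy (M.policy θ) y.1 * M.policy θ y.1 y.2) •
        Matrix.vecMulVec (M.score θ y.1 y.2).ofLp (M.score θ y.1 y.2).ofLp := by
    rw [fisher, Fintype.sum_prod_type]
  have h := naturalGradient_eq (Finset.univ : Finset (M.table × A))
    (p := fun y => M.occupancy (M.policy θ) y.1 * M.policy θ y.1 y.2)
    (fun y => mul_nonneg (M.occupancy_nonneg _ _) (stdSimplex.zero_le _ _))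
    (fun y => (M.score θ y.1 y.2).ofLp)
    (G := (gradient (fun θ' => J (M.policy θ')) θ).ofLp) (w := (M.advantage Q).ofLp)
    (fun z => ?_) (Finset.mem_univ (x, a)) ?_
  · rw [← hfisher] at h
    rw [← sum_score, ← sum_score]
    exact h
  · have h1 := sum_gradient_mul (hasFDerivAt_objective hJ θ) (WithLp.toLp 2 z)
    have h2 : ∀ y : M.table × A, ∑ i, M.score θ y.1 y.2 i * z i =
        softmaxScore (M.coord y.1) θ y.2 (WithLp.toLp 2 z) := fun y => M.sum_score θ _ _ _
    refine h1.trans ?_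
    simp only [h2, sum_score, sum_apply, smul_apply, smul_eq_mul]
    rw [Fintype.sum_prod_type]
    refine Finset.sum_congr rfl fun y _ => ?_
    set s := fun a => softmaxScore (M.coord y) θ a (WithLp.toLp 2 z) with hs
    have hs0 : ∑ a, M.policy θ y a * s a = 0 := by
      rw [policy_apply]
      exact sum_softmaxScore _ _ _
    -- The denominator in `advantage` is the ratio of occupancy to visits, so it converts the
    -- unnormalized policy gradient into the weights of the Fisher matrix.
    have h3 : ∀ a, M.occupancy (M.policy θ) y * (M.advantage Q) (y, a) =
        M.visits (M.policy θ) y * Q y a := fun a => by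
      rw [M.occupancy_eq]
      by_cases hy : M.visits (M.policy θ) y = 0
      · rw [hy]; ring
      · have := (M.pos_of_visits_ne_zero hy).ne'
        simp only [advantage]
        field_simp
    -- Subtracting this baseline is free because the scores average to zero.
    set k := ∑ b, M.policy θ y b * (M.advantage Q) (y, b) with hk
    calc M.visits (M.policy θ) y * ∑ a, Q y a * (M.policy θ y a * s a)
        = ∑ a, M.visits (M.policy θ) y * Q y a * (M.policy θ y a * s a) -
          M.occupancy (M.policy θ) y * k * ∑ a, M.policy θ y a * s a := by
          rw [hs0, mul_zero, sub_zero, Finset.mul_sum]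
          exact Finset.sum_congr rfl fun _ _ => by ring
      _ = _ := by
          rw [Finset.mul_sum, ← Finset.sum_sub_distrib]
          refine Finset.sum_congr rfl fun a _ => ?_
          rw [softmaxScore_coord, ← h3]
          ring
  · refine mul_ne_zero ?_ (M.policy_pos θ x a).ne'
    exact M.occupancy_ne_zero hx

variable (M) in
/-- Cross-entropy of `π_θ` relative to a policy `π`, weighted by the occupancy of `π`. -/
def potential (π : Policy S A N) (θ : M.Param) : ℝ :=
  ∑ x : M.table, M.occupancy π x * ∑ a, π x a * -Real.log (M.policy θ x a)

theorem potential_nonneg (π : Policy S A N) (θ : M.Param) : 0 ≤ M.potential π θ :=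
  Finset.sum_nonneg fun _ _ => mul_nonneg (M.occupancy_nonneg _ _) (Finset.sum_nonneg fun _ _ =>
    mul_nonneg (stdSimplex.zero_le _ _) (neg_nonneg.2
      (Real.log_nonpos (stdSimplex.zero_le _ _) (stdSimplex.le_one _ _))))

/-- `softmax_step` is applied at each table state and averaged over the occupancy of the comparison
policy `π`; by the performance difference identity the first-order terms add up to `J π - J π_θ`.
States that `π` does not visit have weight zero, and at all others `naturalPolicyGradient_eq` is
available. -/
theorem potential_step (hJ : M.toCMDP.IsAdditive J r c L) {π : Policy S A N}
    (hπ : π ∈ M.policies) (θ : M.Param) {α : ℝ} (hα : 0 ≤ α)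
    (hαL : α * (L / (1 - M.γ) / (1 - M.γ)) ≤ 1) :
    M.potential π (θ + α • WithLp.toLp 2 ((pinv (M.fisher θ)).mulVec
      (gradient (fun θ' => J (M.policy θ')) θ).ofLp)) ≤
    M.potential π θ - α * (J π - J (M.policy θ)) +
      α ^ 2 * ((L / (1 - M.γ) / (1 - M.γ)) ^ 2 * ∑ x : M.table, M.occupancy π x) := by
  set W := L / (1 - M.γ) / (1 - M.γ) with hW
  set u : M.Param := WithLp.toLp 2 ((pinv (M.fisher θ)).mulVec
      (gradient (fun θ' => J (M.policy θ')) θ).ofLp) with hu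
  set Q := M.qValue (M.policy θ) r with hQ
  set w := M.advantage Q with hw
  have hγ : 0 < 1 - M.γ := sub_pos.2 M.γ_lt_one
  have hpd := hJ.sub_eq (T := M.table) (π := M.policy θ) (π' := π)
    (fun x hx => by rw [M.policy_default _ hx, hπ x hx])
  rw [← Finset.sum_coe_sort M.table] at hpd
  have key : ∀ x : M.table, M.occupancy π x * ∑ a, π x a * -Real.log (M.policy (θ + α • u) x a) ≤
      M.occupancy π x * ∑ a, π x a * -Real.log (M.policy θ x a) -
        α * (M.visits π x * ∑ a, (π x a - M.policy θ x a) * Q x a) +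
        α ^ 2 * (W ^ 2 * M.occupancy π x) := fun x => by
    by_cases hx : M.occupancy π x = 0
    · have hv : M.visits π x = 0 := by_contra fun hv => M.occupancy_ne_zero hv hx
      simp [hx, hv]
    · have hv := M.visits_ne_zero_of_occupancy hx
      have hb := M.pos_of_visits_ne_zero hv
      have hv' := visits_policy_ne_zero θ hπ hv
      have huw : ∀ a, u (x, a) = w (x, a) +
          (∑ b, M.policy θ x b * u (x, b) - ∑ b, M.policy θ x b * w (x, b)) := fun a => by
        have := naturalPolicyGradient_eq hJ θ hv' a
        rw [softmaxScore_coord, softmaxScore_coord] at this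
        linarith
      -- The factor `b` in the bound on `qValue` cancels against the one in `advantage`, so `W` is
      -- uniform over states.
      have hwb : ∀ a, |w (x, a)| ≤ W := fun a => by
        simp only [hw, advantage]
        rw [abs_div, abs_of_pos (mul_pos hγ hb), div_le_iff₀ (mul_pos hγ hb)]
        refine (M.abs_qValue_le _ hJ.bound _ _).trans_eq ?_
        rw [abs_of_pos hb, hW]
        field_simp
      have hstep := softmax_step (π x) (fun a => θ (x, a)) (fun a => u (x, a))
        (fun a => w (x, a)) hα hwb hαL huw
      have e1 : ∀ θ' : M.Param, M.policy θ' x = softmax fun a => θ' (x, a) := fun θ' =>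
        M.policy_apply θ' x
      rw [e1 (θ + α • u), e1 θ]
      have e2 : M.visits π x * ∑ a, (π x a - softmax (fun a => θ (x, a)) a) * Q x a =
          M.occupancy π x * ∑ a, (π x a - softmax (fun a => θ (x, a)) a) * w (x, a) := by
        rw [M.occupancy_eq, Finset.mul_sum, Finset.mul_sum]
        refine Finset.sum_congr rfl fun a _ => ?_
        have := hb.ne'
        simp only [hw, advantage]
        field_simp
      rw [e2]
      have := mul_le_mul_of_nonneg_left hstep (M.occupancy_nonneg π x)
      refine this.trans_eq ?_
      ring
  calc _ ≤ ∑ x : M.table, (M.occupancy π x * ∑ a, π x a * -Real.log (M.policy θ x a) -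
        α * (M.visits π x * ∑ a, (π x a - M.policy θ x a) * Q x a) +
        α ^ 2 * (W ^ 2 * M.occupancy π x)) := Finset.sum_le_sum fun x _ => key x
    _ = _ := by
      rw [Finset.sum_add_distrib, Finset.sum_sub_distrib, hpd, potential, ← hQ]
      simp only [Finset.mul_sum]

end RCProblem

/-! ### Convergence of quasi-Fejér monotone sequences -/

/-- If the gap were eventually at least `c`, telescoping would bound `c * ∑ α` by the initial
potential plus a summable error. -/
theorem frequently_lt_of_descent {Φ α gap : ℕ → ℝ} {C c : ℝ} (hΦ : ∀ t, 0 ≤ Φ t)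
    (hα : ∀ t, 0 < α t) (hα1 : ¬ Summable α) (hα2 : Summable fun t => α t ^ 2)
    (hC : 0 ≤ C) (h : ∀ᶠ t in atTop, Φ (t + 1) ≤ Φ t - α t * gap t + α t ^ 2 * C) (hc : 0 < c) :
    ∃ᶠ t in atTop, gap t < c := by
  intro hev
  obtain ⟨t₀, ht₀⟩ := eventually_atTop.1 (h.and hev)
  refine hα1 ((summable_nat_add_iff t₀).1 ?_)
  refine summable_of_sum_range_le (c := (Φ t₀ + C * ∑' k, α (k + t₀) ^ 2) / c)
    (fun k => (hα _).le) fun n => ?_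
  have hs : Summable fun k => α (k + t₀) ^ 2 := (summable_nat_add_iff t₀).2 hα2
  have h1 : c * ∑ k ∈ Finset.range n, α (k + t₀) ≤
      Φ t₀ - Φ (n + t₀) + C * ∑ k ∈ Finset.range n, α (k + t₀) ^ 2 := by
    induction n with
    | zero => simp
    | succ n ih =>
      obtain ⟨h2, h3⟩ := ht₀ (n + t₀) (Nat.le_add_left _ _)
      have h4 := mul_le_mul_of_nonneg_left (not_lt.1 h3) (hα (n + t₀)).le
      rw [Finset.sum_range_succ, Finset.sum_range_succ, show n + 1 + t₀ = n + t₀ + 1 by ring]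
      linarith
  rw [le_div_iff₀ hc]
  have h5 := mul_le_mul_of_nonneg_left
    (hs.sum_le_tsum (Finset.range n) fun k _ => sq_nonneg _) hC
  linarith [hΦ (n + t₀)]

/-- Once `Φ` is close to its lower bound at a late index of the subsequence, all later increases are
bounded by a tail of `∑ e`. -/
theorem tendsto_of_quasiFejer {Φ e : ℕ → ℝ} {μ : ℝ} (hμ : ∀ t, μ ≤ Φ t) (he0 : ∀ t, 0 ≤ e t)
    (he : Summable e) (h : ∀ᶠ t in atTop, Φ (t + 1) ≤ Φ t + e t) {φ : ℕ → ℕ} (hφ : StrictMono φ)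
    (hlim : Tendsto (Φ ∘ φ) atTop (𝓝 μ)) : Tendsto Φ atTop (𝓝 μ) := by
  rw [Metric.tendsto_atTop]
  intro ε hε
  obtain ⟨t₀, ht₀⟩ := eventually_atTop.1 h
  have h1 : ∀ᶠ j in atTop, Φ (φ j) < μ + ε / 2 :=
    hlim.eventually_lt_const (by linarith)
  have h2 : ∀ᶠ j in atTop, ∑' k, e (k + φ j) < ε / 2 :=
    ((tendsto_sum_nat_add e).comp hφ.tendsto_atTop).eventually_lt_const (by linarith)
  have h3 : ∀ᶠ j in atTop, t₀ ≤ φ j := hφ.tendsto_atTop.eventually_ge_atTop t₀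
  obtain ⟨j, h1, h2, h3⟩ := (h1.and (h2.and h3)).exists
  refine ⟨φ j, fun t ht => ?_⟩
  obtain ⟨n, rfl⟩ := Nat.exists_eq_add_of_le' ht
  have h4 : Φ (n + φ j) ≤ Φ (φ j) + ∑ k ∈ Finset.range n, e (k + φ j) := by
    clear ht
    induction n with
    | zero => simp
    | succ n ih =>
      have := ht₀ (n + φ j) (by omega)
      rw [Finset.sum_range_succ, show n + 1 + φ j = n + φ j + 1 by ring]
      linarith
  have h5 := ((summable_nat_add_iff (φ j)).2 he).sum_le_tsum (Finset.range n) fun k _ => he0 _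
  rw [Real.dist_eq, abs_of_nonneg (by linarith [hμ (n + φ j)])]
  linarith

/-- A weak Pinsker inequality by way of the Hellinger distance: `log y ≤ y - 1` at `y = √q / √p`
bounds `∑ (√p - √q)²` by the relative entropy, and `(√p + √q)² ≤ 4`. -/
theorem sq_sub_le_relEntropy {ι : Type*} [Fintype ι] (p q : stdSimplex ℝ ι) (hq : ∀ i, 0 < q i)
    (i : ι) : (p i - q i) ^ 2 ≤
      4 * (∑ j, p j * -Real.log (q j) - ∑ j, p j * -Real.log (p j)) := by
  have hterm : ∀ j, 2 * (p j - √(p j) * √(q j)) ≤ p j * -Real.log (q j) - p j * -Real.log (p j) :=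
    fun j => by
      rcases (stdSimplex.zero_le p j).eq_or_lt with h | h
      · simp [← h]
      · have hs := Real.sqrt_pos.2 h
        have ht := Real.sqrt_pos.2 (hq j)
        have h1 := Real.log_le_sub_one_of_pos (div_pos ht hs)
        rw [Real.log_div ht.ne' hs.ne', Real.log_sqrt h.le, Real.log_sqrt (hq j).le] at h1
        have h2 := mul_le_mul_of_nonneg_left h1 h.le
        have h3 : p j * (√(q j) / √(p j)) = √(p j) * √(q j) := by
          rw [mul_div_assoc', div_eq_iff hs.ne']
          nth_rewrite 1 [← Real.mul_self_sqrt h.le]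
          ring
        rw [mul_sub, mul_sub, h3] at h2
        linarith
  have hsum : ∑ j, (√(p j) - √(q j)) ^ 2 = ∑ j, 2 * (p j - √(p j) * √(q j)) := by
    have h1 : ∀ j, (√(p j) - √(q j)) ^ 2 = p j + q j - 2 * (√(p j) * √(q j)) := fun j => by
      rw [sub_sq, Real.sq_sqrt (stdSimplex.zero_le p j), Real.sq_sqrt (stdSimplex.zero_le q j)]
      ring
    simp only [h1, Finset.sum_sub_distrib, Finset.sum_add_distrib, ← Finset.mul_sum,
      stdSimplex.sum_eq_one]
    ring
  have h1 : (√(p i) - √(q i)) ^ 2 ≤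
      ∑ j, p j * -Real.log (q j) - ∑ j, p j * -Real.log (p j) := by
    calc _ ≤ ∑ j, (√(p j) - √(q j)) ^ 2 := Finset.single_le_sum
          (f := fun j => (√(p j) - √(q j)) ^ 2) (fun j _ => sq_nonneg _) (Finset.mem_univ i)
      _ ≤ _ := by
          rw [hsum, ← Finset.sum_sub_distrib]
          exact Finset.sum_le_sum fun j _ => hterm j
  have h2 : (p i - q i) ^ 2 = (√(p i) - √(q i)) ^ 2 * (√(p i) + √(q i)) ^ 2 := by
    rw [← mul_pow]
    congr 1
    nth_rewrite 1 [← Real.mul_self_sqrt (stdSimplex.zero_le p i),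
      ← Real.mul_self_sqrt (stdSimplex.zero_le q i)]
    ring
  have h3 : (√(p i) + √(q i)) ^ 2 ≤ 4 := by
    have hp1 : √(p i) ≤ 1 := Real.sqrt_le_one.2 (stdSimplex.le_one p i)
    have hq1 : √(q i) ≤ 1 := Real.sqrt_le_one.2 (stdSimplex.le_one q i)
    nlinarith [Real.sqrt_nonneg (p i), Real.sqrt_nonneg (q i)]
  rw [h2]
  nlinarith [sq_nonneg (√(p i) - √(q i))]

/-! ### Differences of additive objectives and of their values -/

namespace CMDP

variable {S A : Type*} [Fintype S] [Fintype A] {N : ℕ} {M : CMDP S A N}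
  {J J' : Policy S A N → ℝ} {r r' : AugState S N → A → ℝ} {c c' L L' : ℝ}

theorem IsAdditive.sub (h : M.IsAdditive J r c L) (h' : M.IsAdditive J' r' c' L') :
    M.IsAdditive (fun π => J π - J' π) (fun x a => r x a - r' x a) (c - c') (L + L') := by
  refine ⟨fun x a => ?_, fun π => ?_⟩
  · rw [add_mul]
    exact (abs_sub _ _).trans (add_le_add (h.bound x a) (h'.bound x a))
  · have := (h.tendsto π).sub (h'.tendsto π)
    simp only [expect_sub, Finset.sum_sub_distrib]
    rwa [show J π - J' π - (c - c') = J π - c - (J' π - c') by ring]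

theorem IsAdditive.abs_sub_policy_le (h : M.IsAdditive J r c L) (π π' : Policy S A N) :
    |J π - J π'| ≤ 2 * L / (1 - M.γ) := by
  have h1 := h.abs_sub_le π
  have h2 := h.abs_sub_le π'
  rw [show J π - J π' = (J π - c) - (J π' - c) by ring, mul_div_assoc, two_mul]
  exact (abs_sub _ _).trans (add_le_add h1 h2)

end CMDP

/-! ### The inner problems -/

namespace RCProblem

variable {S A : Type*} [Fintype S] [Fintype A] {N m : ℕ} (M : RCProblem S A N m)

open Classical in
/-- The policy with the given values on the table. -/
def ofTable (p : M.table → stdSimplex ℝ A) : Policy S A N :=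
  fun x => if hx : x ∈ M.table then p ⟨x, hx⟩ else M.default x

theorem ofTable_mem (p : M.table → stdSimplex ℝ A) : M.ofTable p ∈ M.policies :=
  fun _ hx => dif_neg hx

theorem ofTable_restrict {π : Policy S A N} (hπ : π ∈ M.policies) :
    M.ofTable (fun x => π x) = π := by
  funext x
  by_cases hx : x ∈ M.table
  · rw [ofTable, dif_pos hx]
  · rw [ofTable, dif_neg hx, hπ x hx]

theorem continuous_ofTable (x : AugState S N) (a : A) :
    Continuous fun p : M.table → stdSimplex ℝ A => M.ofTable p x a := by
  by_cases hx : x ∈ M.table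
  · simp only [ofTable, dif_pos hx]
    exact (continuous_apply a).comp (continuous_subtype_val.comp (continuous_apply _))
  · simp only [ofTable, dif_neg hx]
    exact continuous_const

variable {M}

theorem continuous_objective {J : Policy S A N → ℝ} {r : AugState S N → A → ℝ} {c L : ℝ}
    (hJ : M.toCMDP.IsAdditive J r c L) : Continuous fun p => J (M.ofTable p) :=
  hJ.continuous (T := M.table) M.continuous_ofTable fun p p' x hx => by
    rw [M.ofTable_mem p x hx, M.ofTable_mem p' x hx]

theorem continuous_JR : Continuous fun p => M.JR (M.ofTable p) := by
  obtain ⟨r, c, L, h⟩ := M.isAdditive_JR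
  exact continuous_objective h

theorem continuous_JC (β : DualParam N m) (i : Fin N) :
    Continuous fun p => M.JC β i (M.ofTable p) := by
  obtain ⟨r, c, L, h⟩ := M.isAdditive_JC β i
  exact continuous_objective h

/-- Admissible policies form a finite product of simplices, on which the feasible set is closed and
`JR` is continuous. -/
theorem exists_optimal_policy {β : DualParam N m} (hβ : M.Feasible β) :
    ∃ π ∈ M.policies, M.Satisfies β π ∧
      ∀ π' ∈ M.policies, M.Satisfies β π' → M.JR π' ≤ M.JR π := by
  have hcl : IsClosed {p : M.table → stdSimplex ℝ A | M.Satisfies β (M.ofTable p)} := by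
    simp only [Satisfies, Set.ofPred_forall]
    exact isClosed_iInter fun i => isClosed_le (continuous_JC β i) continuous_const
  obtain ⟨π₀, h0, h1⟩ := hβ
  obtain ⟨p, hp, hmax⟩ := hcl.isCompact.exists_isMaxOn
    ⟨fun x => π₀ x, by rwa [Set.mem_ofPred_eq, M.ofTable_restrict h0]⟩
    continuous_JR.continuousOn
  refine ⟨M.ofTable p, M.ofTable_mem p, hp, fun π' h2 h3 => ?_⟩
  have := hmax (a := fun x => π' x) (by rwa [Set.mem_ofPred_eq, M.ofTable_restrict h2])
  simpa only [Set.mem_ofPred_eq, M.ofTable_restrict h2] using this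

/-- The total violation attains its minimum on a compact set, and a minimum of zero would be a
feasible policy. The bound `δ` determines how large `K` must be. -/
theorem exists_violation {β : DualParam N m} (hβ : ¬ M.Feasible β) :
    ∃ δ > 0, ∀ π ∈ M.policies, δ ≤ ∑ i, max (M.JC β i π - M.d i) 0 := by
  have hc : Continuous fun p : M.table → stdSimplex ℝ A =>
      ∑ i, max (M.JC β i (M.ofTable p) - M.d i) 0 :=
    continuous_finsetSum _ fun i _ => ((continuous_JC β i).sub continuous_const).max
      continuous_const
  obtain ⟨p, -, hmin⟩ := (isCompact_univ (X := M.table → stdSimplex ℝ A)).exists_isMinOn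
    ⟨fun x => M.default x, Set.mem_univ _⟩ hc.continuousOn
  refine ⟨∑ i, max (M.JC β i (M.ofTable p) - M.d i) 0, ?_, fun π hπ => ?_⟩
  · by_contra h
    have h0 := le_antisymm (not_lt.1 h) (Finset.sum_nonneg fun i _ => le_max_right _ _)
    rw [Finset.sum_eq_zero_iff_of_nonneg (fun i _ => le_max_right _ _)] at h0
    refine hβ ⟨M.ofTable p, M.ofTable_mem p, fun i => ?_⟩
    have := (le_max_left _ _).trans_eq (h0 i (Finset.mem_univ i))
    linarith
  · have := hmin (Set.mem_univ (fun x : M.table => π x))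
    simpa only [Set.mem_ofPred_eq, M.ofTable_restrict hπ] using this

theorem exists_subseq_policies {u : ℕ → Policy S A N} (hu : ∀ n, u n ∈ M.policies) :
    ∃ π ∈ M.policies, ∃ φ : ℕ → ℕ, StrictMono φ ∧
      (∀ x a, Tendsto (fun n => u (φ n) x a) atTop (𝓝 (π x a))) ∧
      Tendsto (fun n => M.JR (u (φ n))) atTop (𝓝 (M.JR π)) ∧
      ∀ β i, Tendsto (fun n => M.JC β i (u (φ n))) atTop (𝓝 (M.JC β i π)) := by
  obtain ⟨p, φ, hφ, h⟩ := CompactSpace.tendsto_subseq fun n (x : M.table) => u n x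
  have key : ∀ f : Policy S A N → ℝ, Continuous (fun p => f (M.ofTable p)) →
      Tendsto (fun n => f (u (φ n))) atTop (𝓝 (f (M.ofTable p))) := fun f hf => by
    have := (hf.tendsto p).comp h
    simpa only [Function.comp_def, M.ofTable_restrict (hu _)] using this
  exact ⟨M.ofTable p, M.ofTable_mem p, φ, hφ,
    fun x a => key (fun π => π x a) (M.continuous_ofTable x a), key _ continuous_JR,
    fun β i => key _ (continuous_JC β i)⟩

theorem sum_feasPenalty_of_satisfies {β : DualParam N m} {π : Policy S A N}
    (h : M.Satisfies β π) : ∑ i, feasPenalty (M.JC β i π - M.d i) = 0 :=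
  Finset.sum_eq_zero fun i _ => if_pos (sub_nonpos.2 (h i))

theorem sum_feasPenalty_of_not_satisfies {β : DualParam N m} {π : Policy S A N}
    (h : ¬ M.Satisfies β π) : ∑ i, feasPenalty (M.JC β i π - M.d i) = ⊤ := by
  simp only [Satisfies, not_forall] at h
  obtain ⟨i, hi⟩ := h
  refine top_le_iff.1 ?_
  have h1 : feasPenalty (M.JC β i π - M.d i) = ⊤ := if_neg (by rwa [sub_nonpos])
  rw [← h1]
  refine Finset.single_le_sum (f := fun i => feasPenalty (M.JC β i π - M.d i))
    (fun j _ => ?_) (Finset.mem_univ i)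
  simp only [feasPenalty]
  split_ifs
  · exact le_rfl
  · exact le_top

theorem innerValue_of_not_feasible {β : DualParam N m} (h : ¬ M.Feasible β) :
    M.innerValue β = ⊥ := by
  refine le_bot_iff.1 (iSup₂_le fun π hπ => ?_)
  rw [sum_feasPenalty_of_not_satisfies fun hs => h ⟨π, hπ, hs⟩, EReal.sub_top]

theorem innerValue_of_optimal {β : DualParam N m} {π : Policy S A N} (hπ : π ∈ M.policies)
    (hs : M.Satisfies β π) (hmax : ∀ π' ∈ M.policies, M.Satisfies β π' → M.JR π' ≤ M.JR π) :
    M.innerValue β = (M.JR π : ℝ) := by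
  refine le_antisymm (iSup₂_le fun π' hπ' => ?_) ?_
  · by_cases h : M.Satisfies β π'
    · rw [sum_feasPenalty_of_satisfies h, sub_zero]
      exact EReal.coe_le_coe_iff.2 (hmax π' hπ' h)
    · rw [sum_feasPenalty_of_not_satisfies h, EReal.sub_top]
      exact bot_le
  · refine le_iSup₂_of_le π hπ ?_
    rw [sum_feasPenalty_of_satisfies hs, sub_zero]

theorem J_of_satisfies (K : ℝ) {β : DualParam N m} {π : Policy S A N} (h : M.Satisfies β π) :
    M.J K β π = M.JR π := by
  rw [J, Finset.sum_eq_zero, mul_zero, sub_zero]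
  exact fun i _ => max_eq_right (sub_nonpos.2 (h i))

/-! #### Convergence of the policy updates -/

variable [Nonempty A]

open Classical in
variable (M) in
/-- The advantage of `π` over `π_t = π'` in the objective of the update rule. -/
def gap (β : DualParam N m) (lam : Fin N → ℝ) (π π' : Policy S A N) : ℝ :=
  if M.Satisfies β π' then M.JR π - M.JR π' else ∑ i, lam i * (M.JC β i π' - M.JC β i π)

/-- In both cases of the update the secondary objective carries an extra factor `α t`. Its
contribution to the descent is of order `α t ^ 2` and is absorbed in `C`, which leaves the main
objective in `gap`. The inequality starts once `α t` is small enough for `potential_step`. -/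
theorem IsPolicyRun.descent {β : DualParam N m} {θ : ℕ → M.Param} (h : M.IsPolicyRun β θ) :
    ∃ (α : ℕ → ℝ) (lam : ℕ → Fin N → ℝ), (∀ t, 0 < α t) ∧ ¬ Summable α ∧
      (Summable fun t => α t ^ 2) ∧ (∀ t i, 0 ≤ lam t i) ∧
      (∀ t, ¬ M.Satisfies β (M.policy (θ t)) →
        (∀ i, M.JC β i (M.policy (θ t)) ≤ M.d i → lam t i = 0) ∧ ∑ i, lam t i = 1) ∧
      ∀ π ∈ M.policies, ∃ C, 0 ≤ C ∧ ∀ᶠ t in atTop, M.potential π (θ (t + 1)) ≤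
        M.potential π (θ t) - α t * M.gap β (lam t) π (M.policy (θ t)) + α t ^ 2 * C := by
  obtain ⟨α, lam, ν, B, hα, hα1, hα2, hlam, hν, hviol, hstep⟩ := h
  refine ⟨α, lam, hα, hα1, hα2, fun t i => (hlam t i).1, hviol, fun π hπ => ?_⟩
  obtain ⟨rR, cR, LR, hR⟩ := M.isAdditive_JR
  choose rC cC LC hC using M.isAdditive_JC β
  replace hR := hR.mono (le_abs_self LR)
  replace hC := fun i => (hC i).mono (le_abs_self (LC i))
  have hB : 0 ≤ B := (hν 0).1.trans (hν 0).2
  have hγ : 0 < 1 - M.γ := sub_pos.2 M.γ_lt_one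
  set LS := ∑ i, B * |LC i| with hLS
  have hLS0 : 0 ≤ LS := Finset.sum_nonneg fun i _ => mul_nonneg hB (abs_nonneg _)
  -- A common bound for the reward functions of both cases, valid for all weights once `α t ≤ 1`.
  set L := |LR| + B * |LR| + LS with hL
  have hLpos : 0 ≤ L := add_nonneg (add_nonneg (abs_nonneg _) (mul_nonneg hB (abs_nonneg _))) hLS0
  set W := L / (1 - M.γ) / (1 - M.γ) with hW
  have hS : ∀ t, M.toCMDP.IsAdditive (fun π => ∑ i, lam t i * M.JC β i π)
      (fun x a => ∑ i, lam t i * rC i x a) (∑ i, lam t i * cC i) LS := fun t =>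
    (CMDP.isAdditive_sum Finset.univ fun i => (hC i).const_mul (lam t i)).mono
      (Finset.sum_le_sum fun i _ => mul_le_mul_of_nonneg_right
        (by rw [abs_of_nonneg (hlam t i).1]; exact (hlam t i).2) (abs_nonneg _))
  have hα0 : Tendsto α atTop (𝓝 0) := by
    have := hα2.tendsto_atTop_zero.sqrt
    simpa only [Real.sqrt_sq (hα _).le, Real.sqrt_zero] using this
  have hα1' : ∀ᶠ t in atTop, α t ≤ 1 := (hα0.eventually_lt_const one_pos).mono fun _ h => h.le
  have hαW : ∀ᶠ t in atTop, α t * W ≤ 1 := by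
    have := hα0.mul_const W
    rw [zero_mul] at this
    exact (this.eventually_lt_const one_pos).mono fun _ h => h.le
  -- The first summand bounds the secondary term at feasible iterates, the second the one at
  -- infeasible iterates.
  set D := 2 * LS / (1 - M.γ) + B * (2 * |LR| / (1 - M.γ)) with hD
  have hD1 : 0 ≤ 2 * LS / (1 - M.γ) := div_nonneg (by linarith) hγ.le
  have hD2 : 0 ≤ B * (2 * |LR| / (1 - M.γ)) :=
    mul_nonneg hB (div_nonneg (by positivity) hγ.le)
  refine ⟨W ^ 2 * ∑ x : M.table, M.occupancy π x + D, add_nonneg (mul_nonneg (sq_nonneg _)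
    (Finset.sum_nonneg fun x _ => M.occupancy_nonneg _ _)) (add_nonneg hD1 hD2), ?_⟩
  filter_upwards [hα1', hαW] with t ht1 htW
  have hαt := (hα t).le
  have hsub := (hS t).abs_sub_policy_le π (M.policy (θ t))
  rw [hstep t]
  by_cases hsat : M.Satisfies β (M.policy (θ t))
  · rw [gap, if_pos hsat, updateGradient, if_pos hsat]
    have hJ : M.toCMDP.IsAdditive (fun π => M.JR π - α t * ∑ i, lam t i * M.JC β i π) _ _ L :=
      (hR.sub ((hS t).const_mul (α t))).mono (by
        rw [abs_of_nonneg hαt, hL]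
        have := mul_le_mul_of_nonneg_right ht1 hLS0
        have := mul_nonneg hB (abs_nonneg LR)
        linarith)
    have key := potential_step hJ hπ (θ t) hαt htW
    have h1 := mul_le_mul_of_nonneg_left (abs_le.1 hsub).2 (sq_nonneg (α t))
    have h2 := mul_nonneg (sq_nonneg (α t)) hD2
    refine key.trans ?_
    rw [hD]
    linarith
  · rw [gap, if_neg hsat, updateGradient, if_neg hsat]
    have hJ : M.toCMDP.IsAdditive
        (fun π => α t * ν t * M.JR π - ∑ i, lam t i * M.JC β i π) _ _ L :=
      ((hR.const_mul (α t * ν t)).sub (hS t)).mono (by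
        rw [abs_of_nonneg (mul_nonneg hαt (hν t).1), hL]
        have h3 : α t * ν t ≤ B := (mul_le_of_le_one_left (hν t).1 ht1).trans (hν t).2
        have := mul_le_mul_of_nonneg_right h3 (abs_nonneg LR)
        linarith [abs_nonneg LR])
    have key := potential_step hJ hπ (θ t) hαt htW
    have h0 : ν t * -(M.JR π - M.JR (M.policy (θ t))) ≤ B * (2 * |LR| / (1 - M.γ)) := by
      refine (mul_le_mul_of_nonneg_left ((neg_le_abs _).trans
        (hR.abs_sub_policy_le π (M.policy (θ t)))) (hν t).1).trans ?_
      exact mul_le_mul_of_nonneg_right (hν t).2 (div_nonneg (by positivity) hγ.le)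
    have h1 := mul_le_mul_of_nonneg_left h0 (sq_nonneg (α t))
    have h2 := mul_nonneg (sq_nonneg (α t)) hD1
    refine key.trans ?_
    rw [hD]
    simp only [mul_sub, Finset.sum_sub_distrib]
    linarith

/-- Along the updates of a strictly feasible inner problem, near-optimal feasible policies occur
arbitrarily late. -/
theorem IsPolicyRun.frequently {β : DualParam N m} {θ : ℕ → M.Param} (h : M.IsPolicyRun β θ)
    (hβ : M.StrictlyFeasible β) {π : Policy S A N} (hπ : π ∈ M.policies)
    (hs : M.Satisfies β π) {η : ℝ} (hη : 0 < η) :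
    ∃ᶠ t in atTop, M.Satisfies β (M.policy (θ t)) ∧ M.JR π - η < M.JR (M.policy (θ t)) := by
  obtain ⟨α, lam, hα, hα1, hα2, hlam, hviol, hdesc⟩ := h.descent
  obtain ⟨π₁, hπ₁, ε, hε, hf⟩ := hβ
  obtain ⟨C, hC, hd⟩ := hdesc π hπ
  obtain ⟨C₁, hC₁, hd₁⟩ := hdesc π₁ hπ₁
  set D := |M.JR π₁ - M.JR π| with hD
  have hD0 : 0 ≤ D := abs_nonneg _
  -- The weight of the strictly feasible policy `π₁`, so small that it changes the reward by at most
  -- `η / 2`.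
  obtain ⟨δ, hδ0, hδ1, hδD⟩ : ∃ δ : ℝ, 0 < δ ∧ δ ≤ 1 ∧ δ * D ≤ η / 2 := by
    refine ⟨min 1 (η / (2 * (D + 1))), lt_min one_pos (by positivity), min_le_left _ _, ?_⟩
    calc _ ≤ η / (2 * (D + 1)) * D := mul_le_mul_of_nonneg_right (min_le_right _ _) hD0
      _ = η / 2 * (D / (D + 1)) := by field_simp
      _ ≤ η / 2 := mul_le_of_le_one_right (by positivity)
          ((div_le_one (by positivity)).2 (by linarith))
  have hev : ∀ᶠ t in atTop,
      (1 - δ) * M.potential π (θ (t + 1)) + δ * M.potential π₁ (θ (t + 1)) ≤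
      (1 - δ) * M.potential π (θ t) + δ * M.potential π₁ (θ t) -
        α t * ((1 - δ) * M.gap β (lam t) π (M.policy (θ t)) +
          δ * M.gap β (lam t) π₁ (M.policy (θ t))) + α t ^ 2 * ((1 - δ) * C + δ * C₁) := by
    filter_upwards [hd, hd₁] with t h1 h2
    have h3 := mul_le_mul_of_nonneg_left h1 (sub_nonneg.2 hδ1)
    have h4 := mul_le_mul_of_nonneg_left h2 hδ0.le
    linarith
  -- At an infeasible iterate only violated constraints carry weight and the weights sum to `1`, so
  -- the margin of `π₁` makes the mixed gap at least `δ * ε`. A smaller gap forces feasibility, and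
  -- a gap below `η / 2` then forces near-optimality.
  have hfreq := frequently_lt_of_descent (c := min (δ * ε) (η / 2))
    (fun t => add_nonneg (mul_nonneg (sub_nonneg.2 hδ1) (potential_nonneg π (θ t)))
      (mul_nonneg hδ0.le (potential_nonneg π₁ (θ t)))) hα hα1 hα2
    (add_nonneg (mul_nonneg (sub_nonneg.2 hδ1) hC) (mul_nonneg hδ0.le hC₁)) hev
    (lt_min (mul_pos hδ0 hε) (by linarith))
  refine hfreq.mono fun t ht => ?_
  by_cases hsat : M.Satisfies β (M.policy (θ t))
  · refine ⟨hsat, ?_⟩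
    rw [gap, if_pos hsat, gap, if_pos hsat] at ht
    have h1 := ht.trans_le (min_le_right _ _)
    have h2 := mul_le_mul_of_nonneg_left (neg_abs_le (M.JR π₁ - M.JR π)) hδ0.le
    rw [← hD] at h2
    linarith
  · exfalso
    obtain ⟨hv0, hv1⟩ := hviol t hsat
    rw [gap, if_neg hsat, gap, if_neg hsat] at ht
    refine absurd (ht.trans_le (min_le_left _ _)) (not_lt.2 ?_)
    calc δ * ε = ∑ i, lam t i * (δ * ε) := by rw [← Finset.sum_mul, hv1, one_mul]
      _ ≤ ∑ i, lam t i * ((1 - δ) * (M.JC β i (M.policy (θ t)) - M.JC β i π) +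
            δ * (M.JC β i (M.policy (θ t)) - M.JC β i π₁)) := by
          refine Finset.sum_le_sum fun i _ => ?_
          by_cases hi : M.JC β i (M.policy (θ t)) ≤ M.d i
          · rw [hv0 i hi, zero_mul, zero_mul]
          · refine mul_le_mul_of_nonneg_left ?_ (hlam t i)
            have h1 := mul_nonneg (sub_nonneg.2 hδ1)
              (sub_nonneg.2 ((hs i).trans (not_le.1 hi).le))
            have h2 : ε ≤ M.JC β i (M.policy (θ t)) - M.JC β i π₁ := by
              linarith [hf i, not_le.1 hi]
            have h3 := mul_le_mul_of_nonneg_left h2 hδ0.le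
            linarith
      _ = _ := by
          rw [Finset.mul_sum, Finset.mul_sum, ← Finset.sum_add_distrib]
          exact Finset.sum_congr rfl fun i _ => by ring

theorem gap_nonneg {β : DualParam N m} {lam : Fin N → ℝ} {π π' : Policy S A N}
    (hπ' : π' ∈ M.policies) (hs : M.Satisfies β π)
    (hmax : ∀ π'' ∈ M.policies, M.Satisfies β π'' → M.JR π'' ≤ M.JR π) (hlam : ∀ i, 0 ≤ lam i)
    (hv : ¬ M.Satisfies β π' → ∀ i, M.JC β i π' ≤ M.d i → lam i = 0) :
    0 ≤ M.gap β lam π π' := by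
  by_cases h : M.Satisfies β π'
  · rw [gap, if_pos h]
    exact sub_nonneg.2 (hmax π' hπ' h)
  · rw [gap, if_neg h]
    refine Finset.sum_nonneg fun i _ => ?_
    by_cases hi : M.JC β i π' ≤ M.d i
    · rw [hv h i hi, zero_mul]
    · exact mul_nonneg (hlam i) (sub_nonneg.2 ((hs i).trans (not_le.1 hi).le))

variable (M) in
/-- The minimum of the potential, attained at the policy itself. -/
def potentialMin (π : Policy S A N) : ℝ :=
  ∑ x : M.table, M.occupancy π x * ∑ a, π x a * -Real.log (π x a)

theorem sq_sub_le_potential (π : Policy S A N) (θ : M.Param) (x : M.table) (a : A) :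
    M.occupancy π x * (π x a - M.policy θ x a) ^ 2 ≤
      4 * (M.potential π θ - M.potentialMin π) := by
  have h0 : ∀ (y : M.table) (b : A), (π y b - M.policy θ y b) ^ 2 ≤ _ := fun y b =>
    sq_sub_le_relEntropy (π y) (M.policy θ y) (M.policy_pos θ y) b
  have h1 : M.potential π θ - M.potentialMin π = ∑ y : M.table, M.occupancy π y *
      (∑ b, π y b * -Real.log (M.policy θ y b) - ∑ b, π y b * -Real.log (π y b)) := by
    simp only [potential, potentialMin, mul_sub, Finset.sum_sub_distrib]
  rw [h1]
  refine (mul_le_mul_of_nonneg_left (h0 x a) (M.occupancy_nonneg _ _)).trans ?_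
  rw [mul_left_comm]
  refine mul_le_mul_of_nonneg_left ?_ (by norm_num)
  refine Finset.single_le_sum (f := fun y : M.table => M.occupancy π y *
      (∑ b, π y b * -Real.log (M.policy θ y b) - ∑ b, π y b * -Real.log (π y b)))
    (fun y _ => mul_nonneg (M.occupancy_nonneg _ _) ?_) (Finset.mem_univ x)
  have := (sq_nonneg _).trans (h0 y a)
  linarith

theorem potentialMin_le (π : Policy S A N) (θ : M.Param) :
    M.potentialMin π ≤ M.potential π θ := by
  rcases isEmpty_or_nonempty M.table with h | ⟨⟨x⟩⟩
  · simp [potential, potentialMin]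
  · obtain ⟨a⟩ := ‹Nonempty A›
    have := (mul_nonneg (M.occupancy_nonneg π x) (sq_nonneg _)).trans
      (sq_sub_le_potential π θ x a)
    linarith

/-- The potential controls the iterates only at states that `π` visits. This suffices: the
performance difference identity based at the iterate weights the states by the visits of `π`, and
the values of the iterates are bounded uniformly. -/
theorem tendsto_objective_of_potential {J : Policy S A N → ℝ} {r : AugState S N → A → ℝ} {c L : ℝ}
    (hJ : M.toCMDP.IsAdditive J r c L) {π : Policy S A N} (hπ : π ∈ M.policies)
    {θ : ℕ → M.Param}
    (h : Tendsto (fun t => M.potential π (θ t)) atTop (𝓝 (M.potentialMin π))) :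
    Tendsto (fun t => J (M.policy (θ t))) atTop (𝓝 (J π)) := by
  have hpol : ∀ (x : M.table) (a : A), M.visits π x ≠ 0 →
      Tendsto (fun t => |π x a - M.policy (θ t) x a|) atTop (𝓝 0) := fun x a hx => by
    have hocc : 0 < M.occupancy π x :=
      (M.occupancy_nonneg π x).lt_of_ne' (M.occupancy_ne_zero hx)
    have h1 : Tendsto (fun t => 4 * (M.potential π (θ t) - M.potentialMin π) / M.occupancy π x)
        atTop (𝓝 0) := by
      simpa using ((h.sub_const (M.potentialMin π)).const_mul 4).div_const (M.occupancy π x)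
    have h2 := (squeeze_zero (fun t => sq_nonneg (π x a - M.policy (θ t) x a)) (fun t => by
      rw [le_div_iff₀ hocc, mul_comm]
      exact sq_sub_le_potential π (θ t) x a) h1).sqrt
    simpa only [Real.sqrt_sq_eq_abs, Real.sqrt_zero] using h2
  have hb : ∀ t, ‖J π - J (M.policy (θ t))‖ ≤ ∑ x : M.table, M.visits π x *
      ∑ a, |π x a - M.policy (θ t) x a| * (L / (1 - M.γ) * |x.1.2.2|) := fun t => by
    rw [hJ.sub_eq (T := M.table) (π := M.policy (θ t)) (π' := π)
      (fun x hx => by rw [M.policy_default _ hx, hπ x hx]), ← Finset.sum_coe_sort M.table]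
    refine (norm_sum_le _ _).trans (Finset.sum_le_sum fun x _ => ?_)
    rw [norm_mul, Real.norm_of_nonneg (M.visits_nonneg _ _)]
    refine mul_le_mul_of_nonneg_left ((norm_sum_le _ _).trans (Finset.sum_le_sum fun a _ => ?_))
      (M.visits_nonneg _ _)
    rw [norm_mul]
    exact mul_le_mul_of_nonneg_left (M.abs_qValue_le _ hJ.bound _ _) (norm_nonneg _)
  have h0 : Tendsto (fun t => ∑ x : M.table, M.visits π x *
      ∑ a, |π x a - M.policy (θ t) x a| * (L / (1 - M.γ) * |x.1.2.2|)) atTop (𝓝 0) := by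
    rw [← Finset.sum_const_zero (s := (Finset.univ : Finset M.table))]
    refine tendsto_finsetSum _ fun x _ => ?_
    by_cases hx : M.visits π x = 0
    · simp only [hx, zero_mul]
      exact tendsto_const_nhds
    · have := (tendsto_finsetSum Finset.univ fun a _ => (hpol x a hx).mul_const
        (L / (1 - M.γ) * |x.1.2.2|)).const_mul (M.visits π x)
      simpa using this
  have h1 := (squeeze_zero_norm hb h0).const_sub (J π)
  simpa using h1

/-- The policy updates of a strictly feasible inner problem converge in penalized objective to the
value of the inner problem. -/
theorem tendsto_J_of_strictlyFeasible {β : DualParam N m} (hβ : M.StrictlyFeasible β) :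
    ∃ v : ℝ, M.innerValue β = v ∧ ∀ (K : ℝ) (θ : ℕ → M.Param), M.IsPolicyRun β θ →
      Tendsto (fun t => M.J K β (M.policy (θ t))) atTop (𝓝 v) := by
  have hfeas : M.Feasible β := by
    obtain ⟨π, hπ, ε, hε, h⟩ := hβ
    exact ⟨π, hπ, fun i => (h i).trans (by linarith)⟩
  obtain ⟨π₀, hπ₀, hs₀, hmax₀⟩ := exists_optimal_policy hfeas
  refine ⟨M.JR π₀, innerValue_of_optimal hπ₀ hs₀ hmax₀, fun K θ hrun => ?_⟩
  -- Feasible iterates with optimality error tending to zero; any cluster point of them is feasible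
  -- and optimal.
  obtain ⟨φ₁, hφ₁, hP⟩ := extraction_forall_of_frequently (P := fun (n : ℕ) t =>
      M.Satisfies β (M.policy (θ t)) ∧ M.JR π₀ - 1 / ((n : ℝ) + 1) < M.JR (M.policy (θ t)))
    fun n => hrun.frequently hβ hπ₀ hs₀ Nat.one_div_pos_of_nat
  obtain ⟨π, hπ, φ₂, hφ₂, hlim, hlimR, hlimC⟩ :=
    exists_subseq_policies (M := M) fun n => M.policy_mem (θ (φ₁ n))
  have hs : M.Satisfies β π := fun i =>
    le_of_tendsto (hlimC β i) (.of_forall fun n => (hP (φ₂ n)).1 i)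
  have hge : M.JR π₀ ≤ M.JR π := by
    have h1 : Tendsto (fun n => M.JR π₀ - 1 / ((φ₂ n : ℝ) + 1)) atTop (𝓝 (M.JR π₀ - 0)) :=
      (tendsto_one_div_add_atTop_nhds_zero_nat.comp hφ₂.tendsto_atTop).const_sub _
    rw [sub_zero] at h1
    exact le_of_tendsto_of_tendsto' h1 hlimR fun n => (hP (φ₂ n)).2.le
  have hmax : ∀ π' ∈ M.policies, M.Satisfies β π' → M.JR π' ≤ M.JR π :=
    fun π' h1 h2 => (hmax₀ π' h1 h2).trans hge
  obtain ⟨α, lam, hα, hα1, hα2, hlam, hviol, hdesc⟩ := hrun.descent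
  -- The comparison policy is now the cluster point itself, since only its own potential approaches
  -- the minimum along the subsequence.
  obtain ⟨C, hC, hd⟩ := hdesc π hπ
  have hpot : Tendsto (fun t => M.potential π (θ t)) atTop (𝓝 (M.potentialMin π)) := by
    refine tendsto_of_quasiFejer (e := fun t => α t ^ 2 * C) (fun t => potentialMin_le π (θ t))
      (fun t => mul_nonneg (sq_nonneg _) hC) (hα2.mul_right C) ?_ (hφ₁.comp hφ₂) ?_
    · filter_upwards [hd] with t ht
      have := mul_nonneg (hα t).le (gap_nonneg (M.policy_mem (θ t)) hs hmax (hlam t)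
        fun h => (hviol t h).1)
      linarith
    · simp only [potential, potentialMin, Function.comp_def]
      refine tendsto_finsetSum _ fun x _ => Tendsto.const_mul _ (tendsto_finsetSum _ fun a _ => ?_)
      -- Where `π` vanishes the logarithm may diverge, but its coefficient is exactly zero.
      by_cases ha : π x a = 0
      · simp only [ha, zero_mul]
        exact tendsto_const_nhds
      · exact ((hlim x a).log ha).neg.const_mul _
  have hR : Tendsto (fun t => M.JR (M.policy (θ t))) atTop (𝓝 (M.JR π)) := by
    obtain ⟨r, c, L, h⟩ := M.isAdditive_JR
    exact tendsto_objective_of_potential h hπ hpot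
  have hCt : ∀ i, Tendsto (fun t => M.JC β i (M.policy (θ t))) atTop (𝓝 (M.JC β i π)) := fun i => by
    obtain ⟨r, c, L, h⟩ := M.isAdditive_JC β i
    exact tendsto_objective_of_potential h hπ hpot
  have hJ : Tendsto (fun t => M.J K β (M.policy (θ t))) atTop (𝓝 (M.J K β π)) :=
    hR.sub ((tendsto_finsetSum _ fun i _ =>
      ((hCt i).sub_const (M.d i)).max tendsto_const_nhds).const_mul K)
  rwa [J_of_satisfies K hs, le_antisymm (hmax₀ π hπ hs) hge] at hJ

end RCProblem

/-! ### The sampler updates -/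

section

variable {ι : Type*} [Fintype ι] [Nonempty ι]

/-- The natural gradient of the cross-entropy relative to a fixed distribution `q` is `-log q`, up
to an additive constant. -/
theorem sampler_naturalGradient (φ : EuclideanSpace ℝ ι) (q : stdSimplex ℝ ι) (i j : ι) :
    (pinv (samplerFisher φ)).mulVec (gradient (fun φ' => crossEntropy (sampler φ') q) φ).ofLp i -
      (pinv (samplerFisher φ)).mulVec
        (gradient (fun φ' => crossEntropy (sampler φ') q) φ).ofLp j =
      Real.log (q j) - Real.log (q i) := by
  set ℓ : ι → EuclideanSpace ℝ ι →L[ℝ] ℝ := fun i => EuclideanSpace.proj i with hℓ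
  set G := gradient (fun φ' => crossEntropy (sampler φ') q) φ with hG
  have hscore : ∀ i (z : EuclideanSpace ℝ ι),
      ∑ k, samplerScore φ i k * z k = softmaxScore ℓ φ i z := fun i z =>
    sum_gradient_mul (hasFDerivAt_log_softmax ℓ φ i) z
  have hcoord : ∀ i (z : EuclideanSpace ℝ ι),
      softmaxScore ℓ φ i z = z i - ∑ k, sampler φ k * z k := fun i z => by
    simp only [softmaxScore, sub_apply, sum_apply, smul_apply, smul_eq_mul]
    rfl
  have hgrad : ∀ z : EuclideanSpace ℝ ι, ∑ k, G k * z k =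
      -∑ i, sampler φ i * softmaxScore ℓ φ i z * Real.log (q i) := fun z => by
    have h : HasFDerivAt (fun φ' => crossEntropy (sampler φ') q)
        (-∑ i, Real.log (q i) • sampler φ i • softmaxScore ℓ φ i) φ :=
      (HasFDerivAt.fun_sum fun i _ => (hasFDerivAt_softmax ℓ φ i).mul_const (Real.log (q i))).neg
    rw [sum_gradient_mul h z]
    simp only [neg_apply, sum_apply, smul_apply, smul_eq_mul]
    congr 1
    exact Finset.sum_congr rfl fun _ _ => by ring
  have key : ∀ i, (pinv (samplerFisher φ)).mulVec G.ofLp i -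
      ∑ k, sampler φ k * (pinv (samplerFisher φ)).mulVec G.ofLp k =
      -Real.log (q i) - ∑ k, sampler φ k * -Real.log (q k) := fun i => by
    have h := naturalGradient_eq (Finset.univ : Finset ι) (p := fun i => sampler φ i)
      (fun i => stdSimplex.zero_le _ _) (fun i => (samplerScore φ i).ofLp) (G := G.ofLp)
      (w := fun i => -Real.log (q i)) (fun z => ?_) (Finset.mem_univ i)
      (softmax_pos (fun i => φ i) i).ne'
    · have h1 := hscore i (WithLp.toLp 2 ((pinv (samplerFisher φ)).mulVec G.ofLp))
      have h2 := hscore i (WithLp.toLp 2 fun i => -Real.log (q i))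
      rw [hcoord] at h1 h2
      exact h1.symm.trans (h.trans h2)
    · have h1 : ∀ i, ∑ k, samplerScore φ i k * z k = softmaxScore ℓ φ i (WithLp.toLp 2 z) :=
        fun i => hscore i (WithLp.toLp 2 z)
      have h2 : ∀ i, ∑ k, samplerScore φ i k * -Real.log (q k) =
          -Real.log (q i) - ∑ k, sampler φ k * -Real.log (q k) := fun i =>
        (hscore i (WithLp.toLp 2 fun i => -Real.log (q i))).trans (hcoord i _)
      have h3 : ∑ i, sampler φ i * softmaxScore ℓ φ i (WithLp.toLp 2 z) = 0 :=
        sum_softmaxScore ℓ φ _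
      refine (hgrad (WithLp.toLp 2 z)).trans ?_
      simp only [h1, h2]
      -- The mean of `-log q` is invisible to the gradient, because the scores average to zero.
      set k := ∑ k, sampler φ k * -Real.log (q k) with hk
      calc _ = -∑ i, sampler φ i * softmaxScore ℓ φ i (WithLp.toLp 2 z) * Real.log (q i) -
            k * ∑ i, sampler φ i * softmaxScore ℓ φ i (WithLp.toLp 2 z) := by
            rw [h3, mul_zero, sub_zero]
        _ = _ := by
            rw [Finset.mul_sum, ← Finset.sum_neg_distrib, ← Finset.sum_sub_distrib]
            exact Finset.sum_congr rfl fun _ _ => by ring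
  linarith [key i, key j]

theorem sampler_le_exp (φ : EuclideanSpace ℝ ι) (i j : ι) :
    sampler φ i ≤ Real.exp (-(φ j - φ i)) := by
  have h : sampler φ i = Real.exp (φ i) / ∑ k, Real.exp (φ k) := rfl
  rw [h, neg_sub, Real.exp_sub]
  refine div_le_div_of_nonneg_left (Real.exp_pos _).le (Real.exp_pos _) ?_
  exact Finset.single_le_sum (f := fun k => Real.exp (φ k)) (fun _ _ => (Real.exp_pos _).le)
    (Finset.mem_univ j)

/-- If the differences `J_t j - J_t i` are eventually bounded below by a positive constant, the
sampler assigns vanishing probability to `i`. -/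
theorem tendsto_sampler_zero {φ : ℕ → EuclideanSpace ℝ ι} {D : ℕ → ℝ} {α c : ℝ} (hα : 0 < α)
    (hc : 0 < c) {i j : ι}
    (hφ : ∀ t, φ (t + 1) j - φ (t + 1) i = φ t j - φ t i + α * D t)
    (hD : ∀ᶠ t in atTop, c ≤ D t) : Tendsto (fun t => sampler (φ t) i) atTop (𝓝 0) := by
  obtain ⟨t₀, ht₀⟩ := eventually_atTop.1 hD
  have h1 : ∀ n : ℕ, φ t₀ j - φ t₀ i + n * (α * c) ≤ φ (n + t₀) j - φ (n + t₀) i := fun n => by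
    induction n with
    | zero => simp
    | succ n ih =>
      have h2 := mul_le_mul_of_nonneg_left (ht₀ (n + t₀) (Nat.le_add_left _ _)) hα.le
      rw [show n + 1 + t₀ = n + t₀ + 1 by ring, hφ]
      push_cast
      linarith
  have h2 : Tendsto (fun n : ℕ => φ t₀ j - φ t₀ i + n * (α * c)) atTop atTop :=
    tendsto_atTop_add_const_left _ _
      (tendsto_natCast_atTop_atTop.atTop_mul_const (mul_pos hα hc))
  have h3 := (tendsto_atTop_mono h1 h2)
  rw [tendsto_add_atTop_iff_nat (f := fun t => φ t j - φ t i)] at h3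
  exact squeeze_zero (fun t => stdSimplex.zero_le _ _) (fun t => sampler_le_exp (φ t) i j)
    (Real.tendsto_exp_neg_atTop_nhds_zero.comp h3)

/-- The distance to the distributions that are supported in `P` is at most the mass outside. -/
theorem infDist_le_sum (P : ι → Prop) [DecidablePred P] {i₀ : ι} (hi₀ : P i₀)
    (ξ : stdSimplex ℝ ι) :
    Metric.infDist ξ {ζ : stdSimplex ℝ ι | ∀ i, ¬ P i → ζ i = 0} ≤
      ∑ i, if P i then 0 else ξ i := by
  classical
  set o : ι → ℝ := fun i => if P i then 0 else ξ i with ho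
  have ho0 : ∀ i, 0 ≤ o i := fun i => by
    simp only [ho]; split_ifs; exacts [le_rfl, stdSimplex.zero_le _ _]
  have ho1 : ∀ i, o i ≤ ξ i := fun i => by
    simp only [ho]; split_ifs; exacts [stdSimplex.zero_le _ _, le_rfl]
  have hs0 : 0 ≤ ∑ i, o i := Finset.sum_nonneg fun i _ => ho0 i
  -- The mass outside `P` is moved to `i₀`; in the sup metric no coordinate changes by more than
  -- that mass.
  let ζ : stdSimplex ℝ ι := ⟨fun i => ξ i - o i + if i = i₀ then ∑ i, o i else 0, fun i => by
      have := ho1 i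
      dsimp only
      split_ifs <;> linarith, by
      simp [Finset.sum_add_distrib]⟩
  have hζ : ∀ i, ζ i = ξ i - o i + if i = i₀ then ∑ i, o i else 0 := fun i => rfl
  have hmem : ζ ∈ {ζ : stdSimplex ℝ ι | ∀ i, ¬ P i → ζ i = 0} := fun i hi => by
    rw [hζ, if_neg fun h : i = i₀ => hi (h ▸ hi₀)]
    simp [ho, hi]
  refine (Metric.infDist_le_dist_of_mem hmem).trans ?_
  refine (dist_pi_le_iff hs0).2 fun i => ?_
  have h1 : dist (ξ i) (ζ i) ≤ ∑ i, o i := by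
    rw [Real.dist_eq, hζ, abs_le]
    have h2 : o i ≤ ∑ i, o i := Finset.single_le_sum (fun i _ => ho0 i) (Finset.mem_univ i)
    have h3 := ho0 i
    split_ifs <;> constructor <;> linarith
  exact h1

end

namespace RCProblem

variable {S A : Type*} [Fintype S] [Fintype A] [Nonempty A] {N m : ℕ} {M : RCProblem S A N m}
  {B : Finset (DualParam N m)} [Nonempty B]

/-- In logit differences both the normalization of the target and the constant left free by the
natural gradient cancel. -/
theorem IsSamplerRun.sub_succ {K α : ℝ} {θ : B → ℕ → M.Param} {φ : ℕ → EuclideanSpace ℝ B}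
    (h : M.IsSamplerRun B K α θ φ) (t : ℕ) (i j : B) :
    φ (t + 1) j - φ (t + 1) i = φ t j - φ t i +
      α * (M.J K j (M.policy (θ j t)) - M.J K i (M.policy (θ i t))) := by
  have h1 := sampler_naturalGradient (φ t) (M.target B K fun β => θ β t) i j
  simp only [target, log_softmax] at h1
  rw [h t]
  simp only [PiLp.sub_apply, PiLp.smul_apply, smul_eq_mul]
  have h2 : M.loss B K (fun β => θ β t) = fun φ' => crossEntropy (sampler φ')
    (softmax fun β : B => M.J K β (M.policy (θ β t))) := rfl
  rw [h2]
  linear_combination α * h1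

theorem IsOptimal.exists (M : RCProblem S A N m) (B : Finset (DualParam N m)) [Nonempty B] :
    ∃ β : B, M.IsOptimal B β := by
  obtain ⟨β, hβ, h⟩ := B.exists_max_image M.innerValue (Finset.nonempty_coe_sort.1 ‹_›)
  exact ⟨⟨β, hβ⟩, hβ, h⟩

/-- For large penalties, the penalized objectives at an optimal parameter eventually exceed those
at a parameter that is not optimal. -/
theorem exists_eventually_lt (M : RCProblem S A N m) {B : Finset (DualParam N m)}
    (hfeas : ∀ β ∈ B, M.StrictlyFeasible β ∨ ¬ M.Feasible β) {β₀ : B} (hβ₀ : M.IsOptimal B β₀) :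
    ∃ K₀ > 0, ∀ K > 0, (K₀ ≤ K ∨ ∀ β ∈ B, M.StrictlyFeasible β) →
      ∀ θ : B → ℕ → M.Param, (∀ β : B, M.IsPolicyRun β (θ β)) →
      ∀ β : B, ¬ M.IsOptimal B β → ∃ c > 0, ∀ᶠ t in atTop,
        c ≤ M.J K β₀ (M.policy (θ β₀ t)) - M.J K β (M.policy (θ β t)) := by
  have hlt : ∀ β : B, ¬ M.IsOptimal B β → M.innerValue β < M.innerValue β₀ := fun β hβ => by
    by_contra h
    exact hβ ⟨β.2, fun β' hβ' => (hβ₀.2 β' hβ').trans (not_lt.1 h)⟩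
  rcases hfeas β₀ β₀.2 with hstr | hinf
  · obtain ⟨v, hv, hconv⟩ := tendsto_J_of_strictlyFeasible hstr
    obtain ⟨r, cR, L, hR⟩ := M.isAdditive_JR
    have hδ : ∀ β : B, ∃ δ > 0, ¬ M.Feasible β →
        ∀ π ∈ M.policies, δ ≤ ∑ i, max (M.JC β i π - M.d i) 0 := fun β => by
      by_cases h : M.Feasible β
      · exact ⟨1, one_pos, fun h' => absurd h h'⟩
      · obtain ⟨δ, h1, h2⟩ := exists_violation h
        exact ⟨δ, h1, fun _ => h2⟩
    choose δ hδ0 hδ using hδ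
    -- As `cR + L / (1 - γ)` bounds `JR` from above, `b ≤ K * δ β` keeps the penalized objective at
    -- an infeasible `β` below `v - 1`; the objective at `β₀` eventually exceeds `v - 1 / 2`.
    set b := cR + L / (1 - M.γ) - v + 1 with hb
    have hnn : ∀ β : B, 0 ≤ |b| / δ β := fun β => div_nonneg (abs_nonneg _) (hδ0 β).le
    refine ⟨1 + ∑ β : B, |b| / δ β,
      add_pos_of_pos_of_nonneg one_pos (Finset.sum_nonneg fun β _ => hnn β),
      fun K hK hK₀ θ hθ β hβ => ?_⟩
    have h₀ := hconv K (θ β₀) (hθ β₀)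
    rcases hfeas β β.2 with hs | hi
    · obtain ⟨w, hw, hconvw⟩ := tendsto_J_of_strictlyFeasible hs
      have hwv : w < v := by
        have := hlt β hβ
        rwa [hv, hw, EReal.coe_lt_coe_iff] at this
      refine ⟨(v - w) / 2, by linarith, ?_⟩
      exact ((h₀.sub (hconvw K (θ β) (hθ β))).eventually_const_lt (by linarith)).mono
        fun _ h => h.le
    -- A lower bound on `K` matters only here, where some inner problem is infeasible.
    · have hle : 1 + ∑ β : B, |b| / δ β ≤ K := hK₀.resolve_right fun h => by
        obtain ⟨π, hπ, ε, hε, h⟩ := h β β.2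
        exact hi ⟨π, hπ, fun i => (h i).trans (by linarith)⟩
      have hKb : b ≤ K * δ β := by
        have h1 : |b| / δ β ≤ K := by
          have := Finset.single_le_sum (f := fun β : B => |b| / δ β) (fun β _ => hnn β)
            (Finset.mem_univ β)
          linarith
        exact (le_abs_self b).trans ((div_le_iff₀ (hδ0 β)).1 h1)
      refine ⟨1 / 2, by norm_num, ?_⟩
      filter_upwards [h₀.eventually_const_lt (show v - 1 / 2 < v by linarith)] with t ht
      have h1 := mul_le_mul_of_nonneg_left (hδ β hi _ (M.policy_mem (θ β t))) hK.le
      have h2 := (abs_le.1 (hR.abs_sub_le (M.policy (θ β t)))).2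
      have h3 : M.J K β (M.policy (θ β t)) = M.JR (M.policy (θ β t)) -
        K * ∑ i, max (M.JC β i (M.policy (θ β t)) - M.d i) 0 := rfl
      linarith
  -- If the inner problem at an optimal parameter is infeasible, all values are `⊥` and every
  -- parameter is optimal.
  · refine ⟨1, one_pos, fun K _ _ θ _ β hβ => ?_⟩
    have := hlt β hβ
    rw [innerValue_of_not_feasible hinf] at this
    exact absurd this not_lt_bot

end RCProblem

end

/-! ### Convergence of the sampler -/

theorem mainTheorem3 {S A : Type*} [Fintype S] [Fintype A] [Nonempty A] {N m : ℕ}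
    (M : RCProblem S A N m) (B : Finset (DualParam N m)) [Nonempty B]
    (hB : ∀ β ∈ B, ∀ i, Monotone (β i))
    (hfeas : ∀ β ∈ B, M.StrictlyFeasible β ∨ ¬ M.Feasible β) :
    ∃ K₀ > 0, ∀ K > 0, (K₀ ≤ K ∨ ∀ β ∈ B, M.StrictlyFeasible β) →
      ∀ α > 0, ∀ θ : B → ℕ → M.Param, (∀ β : B, M.IsPolicyRun β (θ β)) →
      ∀ φ : ℕ → EuclideanSpace ℝ B, M.IsSamplerRun B K α θ φ →
        (M.optimalDistributions B).Nonempty ∧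
        Tendsto (fun t => Metric.infDist (sampler (φ t)) (M.optimalDistributions B))
          atTop (𝓝 0) ∧
        (∀ β : B, ¬ M.IsOptimal B β → Tendsto (fun t => sampler (φ t) β) atTop (𝓝 0)) ∧
        (∀ β : B, (∀ β' : B, M.IsOptimal B β' ↔ β' = β) →
          Tendsto (fun t => sampler (φ t) β) atTop (𝓝 1)) := by
  classical
  obtain ⟨β₀, hβ₀⟩ := RCProblem.IsOptimal.exists M B
  obtain ⟨K₀, hK₀, h⟩ := M.exists_eventually_lt hfeas hβ₀
  refine ⟨K₀, hK₀, fun K hK hKK α hα θ hθ φ hφ => ?_⟩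
  have hzero : ∀ β : B, ¬ M.IsOptimal B β → Tendsto (fun t => sampler (φ t) β) atTop (𝓝 0) :=
    fun β hβ => by
      obtain ⟨c, hc, hev⟩ := h K hK hKK θ hθ β hβ
      exact tendsto_sampler_zero hα hc (fun t => hφ.sub_succ t β β₀) hev
  refine ⟨⟨stdSimplex.vertex β₀, fun β hβ => ?_⟩, ?_, hzero, fun β hβ => ?_⟩
  · have hne : β ≠ β₀ := fun h => hβ (h ▸ hβ₀)
    simp [hne]
  · refine squeeze_zero (fun _ => Metric.infDist_nonneg)
      (fun t => infDist_le_sum (fun β : B => M.IsOptimal B β) hβ₀ (sampler (φ t))) ?_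
    have h1 : ∀ β : B, Tendsto (fun t => if M.IsOptimal B β then 0 else sampler (φ t) β) atTop
        (𝓝 0) := fun β => by
      split_ifs with hβ
      · exact tendsto_const_nhds
      · exact hzero β hβ
    simpa using tendsto_finsetSum Finset.univ fun β _ => h1 β
  · have h1 : ∀ t, sampler (φ t) β = 1 - ∑ β' ∈ Finset.univ.erase β, sampler (φ t) β' := fun t => by
      have h2 := stdSimplex.sum_eq_one (sampler (φ t))
      rw [← Finset.add_sum_erase _ _ (Finset.mem_univ β)] at h2
      linarith
    simp only [h1]
    have h2 : Tendsto (fun t => ∑ β' ∈ Finset.univ.erase β, sampler (φ t) β') atTop (𝓝 0) := by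
      rw [← Finset.sum_const_zero (s := Finset.univ.erase β)]
      exact tendsto_finsetSum _ fun β' hβ' =>
        hzero β' fun ho => Finset.ne_of_mem_erase hβ' ((hβ β').1 ho)
    simpa using h2.const_sub 1
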